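/- A \emph{tsi group} is a group $G$ with a metric $d$ such that $d(gf_1,gf_2)=d(f_1,f_2)=d(f_1g,f_2g)$ for all $g,f_1,f_2\in G$. The density character $\chi(X)$ of a metric space $X$ is the smallest cardinality of a dense subset of $X$. Let $(G_\lambda,d_\lambda)_{\lambda\in\Lambda}$ be a nonempty family of tsi groups with a common subgroup $A$ that is closed in every $G_\lambda$, with $G_{\lambda_1}\cap G_{\lambda_2}=A$ for $\lambda_1\neq\lambda_2$, such that all the metrics $d_\lambda$ agree on $A$. Let $\coprod_A G_\lambda$ be the free product of the $G_\lambda$ with amalgamation over $A$. On $G=\bigcup_\lambda G_\lambda$ let $d$ be the amalgam metric: $d(x,y)=d_\lambda(x,y)$ if $x,y\in G_\lambda$ for some $\lambda$, and $d(x,y)=\inf_{a\in A}\big(d_{\lambda_1}(x,a)+d_{\lambda_2}(a,y)\big)$ if $x\in G_{\lambda_1}$, $y\in G_{\lambda_2}$, $\lambda_1\ne\lambda_2$. For a nonempty finite word $\alpha$ over the alphabet $G$ let $\hat\alpha\in\coprod_A G_\lambda$ be the product of its letters, and for words $\alpha,\beta$ of the same length $n$ let $\rho(\alpha,\beta)=\sum_{i=1}^n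 d(\alpha(i),\beta(i))$. The Graev metric on $\coprod_A G_\lambda$ is $$\underline d(f_1,f_2)=\inf\{\rho(\alpha_1,\alpha_2) : |\alpha_1|=|\alpha_2|,\ \hat\alpha_1=f_1,\ \hat\alpha_2=f_2\}.$$ Then $\underline d$ is a metric, and it has the following properties. (i) If $(T,d_T)$ is a tsi group and $\phi_\lambda:G_\lambda\to T$ are $K$-Lipschitz homomorphisms ($K$ independent of $\lambda$) with $\phi_{\lambda_1}(a)=\phi_{\lambda_2}(a)$ for all $a\in A$ and $\lambda_1,\lambda_2\in\Lambda$, then there is a unique $K$-Lipschitz homomorphism $\phi:\coprod_A G_\lambda\to T$ that extends all $\phi_\lambda$. (ii) Let $H_\lambda\le G_\lambda$ be subgroups with $A\le H_\lambda$ for all $\lambda$, with the metrics induced from $G_\lambda$. The natural homomorphism $\coprod_A H_\lambda\to\coprod_A G_\lambda$ is injective, and the Graev metric on $\coprod_A H_\lambda$ is the metric induced by this embedding from the Graev metric on $\coprod_A G_\lambda$. Moreover, if every $H_\lambda$ is closed in $G_\lambda$, then $\coprod_A H_\lambda$ is a closed subgroup of $\coprod_A G_\lambda$. (iii) $\underline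 d$ is maximal among all tsi metrics on $\coprod_A G_\lambda$ that extend $d$: it is itself a two-sided invariant metric that extends $d$, and if $\delta$ is any two-sided invariant metric on $\coprod_A G_\lambda$ that extends $d$, then $\delta(f_1,f_2)\le\underline d(f_1,f_2)$ for all $f_1,f_2\in\coprod_A G_\lambda$. (iv) If $\Lambda'=\{\lambda\in\Lambda: G_\lambda\ne A\}$ and $|\Lambda'|\ge 2$, then $$\chi\big(\textstyle\coprod_A G_\lambda\big)=\max\big\{\aleph_0,\ \sup\{\chi(G_\lambda):\lambda\in\Lambda\},\ |\Lambda'|\big\}.$$ Moreover, if $\Lambda$ is at most countable and all $G_\lambda$ are separable, then $\coprod_A G_\lambda$ is separable. -/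

import Mathlib

universe u v w t

open Monoid Cardinal
open scoped NNReal

/-- A distance function on a group is two-sided invariant. A tsi group is a group with a
metric whose distance function has this property. -/
def IsTwoSidedInvariant {G : Type*} [Group G] (d : G → G → ℝ) : Prop :=
  ∀ g f₁ f₂ : G, d (g * f₁) (g * f₂) = d f₁ f₂ ∧ d (f₁ * g) (f₂ * g) = d f₁ f₂

/-- The density character: the smallest cardinality of a dense subset. -/
noncomputable def densityCharacter (X : Type*) [TopologicalSpace X] : Cardinal :=
  sInf {κ | ∃ S : Set X, Dense S ∧ #S = κ}

section Amalgam

variable {A : Type*} [Group A] {Λ : Type*} {G : Λ → Type*} [∀ i, Group (G i)]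

/-- A group `A` embedded in the groups `G i` by the homomorphisms `φ i`. The free product of the
`G i` with amalgamation over `A` is `Monoid.PushoutI φ`. A letter is an element of some `G i`,
tagged by the index `i`; a letter `⟨i, φ i a⟩` stands for `a`, whichever `i` is used. -/
abbrev Letter (G : Λ → Type*) : Type _ := Σ i, G i

/-- The element of the amalgam given by a letter. -/
def letterVal (φ : ∀ i, A →* G i) (x : Letter G) : PushoutI φ := PushoutI.of x.1 x.2

/-- The evaluation `α ↦ α(1) ⋯ α(n)` of a word in the amalgam. -/
def wordVal (φ : ∀ i, A →* G i) (α : List (Letter G)) : PushoutI φ :=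
  (α.map (letterVal φ)).prod

open Classical in
/-- The amalgam metric on the union of the `G i` over `A`: the metric of `G i` for two
letters from `G i`, and `inf_{a ∈ A} (d_i(x, a) + d_j(a, y))` for `x ∈ G i`, `y ∈ G j` with
`i ≠ j`. -/
noncomputable def letterDist [∀ i, MetricSpace (G i)] (φ : ∀ i, A →* G i)
    (x y : Letter G) : ℝ :=
  if h : x.1 = y.1 then dist (cast (congrArg G h) x.2) y.2
  else ⨅ a : A, (dist x.2 (φ x.1 a) + dist (φ y.1 a) y.2)

theorem letterDist_same [∀ i, MetricSpace (G i)] (φ : ∀ i, A →* G i) (i : Λ) (x y : G i) :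
    letterDist φ ⟨i, x⟩ ⟨i, y⟩ = dist x y := by
  simp [letterDist]

theorem letterDist_of_ne [∀ i, MetricSpace (G i)] (φ : ∀ i, A →* G i) {i j : Λ} (h : i ≠ j)
    (x : G i) (y : G j) :
    letterDist φ ⟨i, x⟩ ⟨j, y⟩ = ⨅ a : A, (dist x (φ i a) + dist (φ j a) y) := by
  simp [letterDist, h]

/-- `ρ(α, β) = ∑ d(α(i), β(i))`, used for words of the same length. -/
noncomputable def wordDist [∀ i, MetricSpace (G i)] (φ : ∀ i, A →* G i)
    (α β : List (Letter G)) : ℝ :=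
  (List.zipWith (letterDist φ) α β).sum

/-- The Graev metric on the amalgam: the infimum of `ρ(α, β)` over all pairs of nonempty words
of the same length which evaluate to `f` and `g`. -/
noncomputable def graevDist [∀ i, MetricSpace (G i)] (φ : ∀ i, A →* G i)
    (f g : PushoutI φ) : ℝ :=
  sInf {r | ∃ α β : List (Letter G), α ≠ [] ∧ α.length = β.length ∧
    wordVal φ α = f ∧ wordVal φ β = g ∧ wordDist φ α β = r}

/-- The embeddings of `A` into subgroups `H i` of `G i` that contain `A`. -/
def embedSub (φ : ∀ i, A →* G i) (H : ∀ i, Subgroup (G i)) (hH : ∀ i, (φ i).range ≤ H i)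
    (i : Λ) : A →* H i :=
  (φ i).codRestrict (H i) (fun a => hH i ⟨a, rfl⟩)

/-- The natural homomorphism from the amalgam of the subgroups `H i` over `A` to the amalgam of
the groups `G i` over `A`, which sends each `x ∈ H i` to `x ∈ G i`. -/
def amalgamInclusion (φ : ∀ i, A →* G i) (H : ∀ i, Subgroup (G i))
    (hH : ∀ i, (φ i).range ≤ H i) : PushoutI (embedSub φ H hH) →* PushoutI φ :=
  PushoutI.lift (fun i => (PushoutI.of i).comp (H i).subtype) (PushoutI.base φ)
    (fun i => PushoutI.of_comp_eq_base i)

end Amalgam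

/-!
The words of length `n` that compete in the definition of the Graev distance may pass through
arbitrary cancellations, and the difficulty is to bound the distance from below. All lower bounds
come from one inductive relation: `Evaluates φ w i g r` says that the word `w` can be evaluated to
`g ∈ G i` with total error `r` by a bracketing in which letters are multiplied inside the factors
only, errors are made inside the factors only, and only elements of `A` are passed from one factor
to another. The word itself is never lengthened in the process.

The key fact is `Evaluates.of_wordVal_eq`: words with the same value in the amalgam have the same
evaluations. It suffices to see that a pair of adjacent inverse letters can be cancelled
(`Evaluates.cancel`). Each letter of the pair belongs to a block which is multiplied in its factor,
and each block either is completed to an element of `A` or is the one that gives the final value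
(`Evaluates.cons_cases`, `Evaluates.concat_cases`); by two-sided invariance the two blocks can be
joined without additional error. Hence exchangeability of words is a congruence whose quotient
monoid receives compatible homomorphisms from the factors, and so a homomorphism from the amalgam.

Consequently `graevDist φ f g < r` implies that every word for `f g⁻¹` evaluates to `1` with
error `r`, and conversely such an evaluation bounds the Graev distance
(`EvaluatesAt.of_graevDist_lt`, `Evaluates.graevDist_le`). As one is free to choose the word, the
statements follow by short inductions on evaluations:
* a single letter has only the obvious evaluations, so the Graev distance extends the amalgam
  metric (`graevDist_letterVal`);
* an evaluation of a word over subgroups `H i` can be followed inside the `H i`, so the Graev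
  distance is inherited by amalgams of subgroups (`graevDist_amalgamInclusion`);
* evaluations of a word over the `H i` followed by a reduced word are costly, so an element outside
  the amalgam of closed subgroups has positive distance from it (`exists_pos_le_graevDist`). For
  `H i = A` this yields that the Graev distance separates points.

Maximality and the universal property only need that a two-sided invariant metric is subadditive on
products. For the density character, words over dense subsets of the factors are dense; conversely,
the factors embed isometrically, the amalgam is infinite, and elements outside `A` of different
factors are centres of disjoint balls.
-/

/-! ### Evaluations of words with errors -/

section Evaluation

variable {A : Type*} [Group A] {Λ : Type*} {G : Λ → Type*} [∀ i, Group (G i)]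
  [∀ i, MetricSpace (G i)] {φ : ∀ i, A →* G i}

/-- `Evaluates φ w i g r`: the word `w` can be evaluated to `g ∈ G i` with total error at most `r`.
Letters may be multiplied only inside a single factor `G i`, and only values in `A` may be passed
from one factor to another; at any time the current value may be changed within its factor, at the
cost of the distance. Letters are never split, and nothing is ever inserted into the word: this is
what makes lower bounds on the cost accessible to induction. -/
inductive Evaluates (φ : ∀ i, A →* G i) : List (Letter G) → (i : Λ) → G i → ℝ → Prop
  | nil (i : Λ) : Evaluates φ [] i 1 0
  | single (i : Λ) (x : G i) : Evaluates φ [⟨i, x⟩] i x 0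
  | append {w w' : List (Letter G)} {i : Λ} {g g' : G i} {r r' : ℝ} :
      Evaluates φ w i g r → Evaluates φ w' i g' r' → Evaluates φ (w ++ w') i (g * g') (r + r')
  | move {w : List (Letter G)} {i : Λ} {g g' : G i} {r s : ℝ} :
      Evaluates φ w i g r → dist g g' ≤ s → Evaluates φ w i g' (r + s)
  | retag {w : List (Letter G)} {i : Λ} {a : A} {r : ℝ} (j : Λ) :
      Evaluates φ w i (φ i a) r → Evaluates φ w j (φ j a) r

namespace IsTwoSidedInvariant

variable {H : Type*} [Group H] [MetricSpace H]

theorem dist_mul_mul_le (h : IsTwoSidedInvariant (dist : H → H → ℝ)) (x y x' y' : H) :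
    dist (x * y) (x' * y') ≤ dist x x' + dist y y' := by
  calc dist (x * y) (x' * y') ≤ dist (x * y) (x' * y) + dist (x' * y) (x' * y') :=
        dist_triangle _ _ _
    _ = _ := by rw [(h y x x').2, (h x' y y').1]

theorem dist_mul_inv_one (h : IsTwoSidedInvariant (dist : H → H → ℝ)) (x y : H) :
    dist (x * y⁻¹) 1 = dist x y := by
  rw [← (h y (x * y⁻¹) 1).2, inv_mul_cancel_right, one_mul]

/-- An error can be carried past a factor on its left at no extra cost. -/
theorem dist_mul_mul_left (h : IsTwoSidedInvariant (dist : H → H → ℝ)) (x y z : H) :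
    dist (x * z) (x * y * z) = dist y 1 := by
  rw [mul_assoc, (h x _ _).1, ← (h z y 1).2, one_mul, dist_comm]

end IsTwoSidedInvariant

namespace Evaluates

theorem weaken {w : List (Letter G)} {i : Λ} {g g' : G i} {r r' : ℝ} (h : Evaluates φ w i g r)
    (hr : r + dist g g' ≤ r') : Evaluates φ w i g' r' := by
  have := h.move (s := r' - r) (g' := g') (by linarith)
  rwa [add_sub_cancel] at this

theorem congr {w : List (Letter G)} {i : Λ} {g g' : G i} {r r' : ℝ} (h : Evaluates φ w i g r)
    (hg : g = g') (hr : r ≤ r') : Evaluates φ w i g' r' :=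
  h.weaken (by simpa [hg] using hr)

/-- An evaluation to the identity of one factor is an evaluation to the identity of every factor. -/
theorem retag_one {w : List (Letter G)} {i : Λ} {r : ℝ} (h : Evaluates φ w i 1 r) (j : Λ) :
    Evaluates φ w j 1 r := by
  have := Evaluates.retag (φ := φ) (i := i) (a := 1) j (by simpa using h)
  simpa using this

theorem nonneg {w : List (Letter G)} {i : Λ} {g : G i} {r : ℝ} (h : Evaluates φ w i g r) :
    0 ≤ r := by
  induction h with
  | nil => rfl
  | single => rfl
  | append _ _ h h' => exact add_nonneg h h'
  | move _ hs h => exact add_nonneg h (dist_nonneg.trans hs)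
  | retag _ _ h => exact h

theorem dist_one_le_of_nil (hG : ∀ i, IsTwoSidedInvariant (dist : G i → G i → ℝ))
    (hagree : ∀ i j, ∀ a b : A, dist (φ i a) (φ i b) = dist (φ j a) (φ j b))
    {i : Λ} {g : G i} {r : ℝ} (h : Evaluates φ [] i g r) : dist g 1 ≤ r := by
  generalize hw : ([] : List (Letter G)) = w at h
  induction h with
  | nil => simp
  | single => simp at hw
  | append _ _ h h' =>
    obtain ⟨rfl, rfl⟩ := List.append_eq_nil_iff.1 hw.symm
    have := (hG _).dist_mul_mul_le (x := _) (y := _) (x' := 1) (y' := 1) |>.trans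
      (add_le_add (h rfl) (h' rfl))
    simpa using this
  | move _ hs h =>
    have := h hw
    rename_i g g' _ _ _
    have := dist_triangle g' g 1
    rw [dist_comm g' g] at this
    linarith
  | @retag _ i a _ j _ h =>
    have := h hw
    have h1 := hagree i j a 1
    rw [map_one, map_one] at h1
    rwa [← h1]

/-- The first letter of an evaluated word either takes part in the final product, so that it can be
divided off, or lies in a block `X :: v₁` which is evaluated in the factor of `X` to an element
of `A` before it takes part in the final product. -/
theorem cons_cases (hG : ∀ i, IsTwoSidedInvariant (dist : G i → G i → ℝ))
    (hagree : ∀ i j, ∀ a b : A, dist (φ i a) (φ i b) = dist (φ j a) (φ j b))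
    {X : Letter G} {v : List (Letter G)} {j : Λ} {g : G j} {r : ℝ}
    (h : Evaluates φ (X :: v) j g r) :
    (∃ y : G j, X = ⟨j, y⟩ ∧ Evaluates φ v j (y⁻¹ * g) r) ∨
    ∃ v₁ v₂ b g₂ r₁ r₂, v = v₁ ++ v₂ ∧ Evaluates φ v₁ X.1 (X.2⁻¹ * φ X.1 b) r₁ ∧
      Evaluates φ v₂ j g₂ r₂ ∧ g = φ j b * g₂ ∧ r = r₁ + r₂ := by
  generalize hw : X :: v = w at h
  induction h generalizing v with
  | nil => simp at hw
  | single i x =>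
    obtain ⟨rfl, rfl⟩ := List.cons_eq_cons.1 hw
    exact .inl ⟨x, rfl, by simpa using Evaluates.nil i⟩
  | @append w w' i g g' r r' hl hr ihl ihr =>
    rcases List.cons_eq_append_iff.1 hw with ⟨rfl, rfl⟩ | ⟨v', rfl, rfl⟩
    · have h0 := dist_one_le_of_nil hG hagree hl
      rcases ihr rfl with ⟨y, rfl, h⟩ | ⟨v₁, v₂, b, g₂, r₁, r₂, rfl, h₁, h₂, rfl, rfl⟩
      · refine .inl ⟨y, rfl, h.weaken ?_⟩
        rw [← mul_assoc, (hG i).dist_mul_mul_left, add_comm]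
        gcongr
      · refine .inr ⟨v₁, v₂, b, (φ i b)⁻¹ * (g * (φ i b * g₂)), r₁, r + r₂, rfl, h₁,
          h₂.weaken ?_, by group, by ring⟩
        rw [← (hG i (φ i b) _ _).1, mul_inv_cancel_left, ← one_mul (φ i b * g₂), ← mul_assoc g,
          (hG i _ _ _).2, mul_one, dist_comm]
        linarith
    · rcases ihl rfl with ⟨y, rfl, h⟩ | ⟨v₁, v₂, b, g₂, r₁, r₂, rfl, h₁, h₂, rfl, rfl⟩
      · exact .inl ⟨y, rfl, (h.append hr).congr (by group) le_rfl⟩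
      · exact .inr ⟨v₁, v₂ ++ w', b, g₂ * g', r₁, r₂ + r', by simp, h₁, h₂.append hr,
          by group, by ring⟩
  | @move w i g g' r s h hs ih =>
    rcases ih hw with ⟨y, rfl, h⟩ | ⟨v₁, v₂, b, g₂, r₁, r₂, rfl, h₁, h₂, rfl, rfl⟩
    · exact .inl ⟨y, rfl, h.move (by rwa [(hG i _ _ _).1])⟩
    · refine .inr ⟨v₁, v₂, b, (φ i b)⁻¹ * g', r₁, r₂ + s, rfl, h₁, h₂.move ?_, by group, by ring⟩
      rwa [← (hG i (φ i b) _ _).1, mul_inv_cancel_left]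
  | @retag w i a r l h ih =>
    rcases ih hw with ⟨y, rfl, h⟩ | ⟨v₁, v₂, b, g₂, r₁, r₂, rfl, h₁, h₂, hg, rfl⟩
    · exact .inr ⟨v, [], a, 1, r, 0, by simp, h, .nil l, by simp, by simp⟩
    · obtain rfl : g₂ = φ i (b⁻¹ * a) := by rw [map_mul, hg, map_inv]; group
      exact .inr ⟨v₁, v₂, b, φ l (b⁻¹ * a), r₁, r₂, rfl, h₁, h₂.retag l, by simp, rfl⟩

/-- The mirror image of `Evaluates.cons_cases`. -/
theorem concat_cases (hG : ∀ i, IsTwoSidedInvariant (dist : G i → G i → ℝ))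
    (hagree : ∀ i j, ∀ a b : A, dist (φ i a) (φ i b) = dist (φ j a) (φ j b))
    {X : Letter G} {u : List (Letter G)} {j : Λ} {g : G j} {r : ℝ}
    (h : Evaluates φ (u ++ [X]) j g r) :
    (∃ y : G j, X = ⟨j, y⟩ ∧ Evaluates φ u j (g * y⁻¹) r) ∨
    ∃ u₁ u₂ b g₁ r₁ r₂, u = u₁ ++ u₂ ∧ Evaluates φ u₁ j g₁ r₁ ∧
      Evaluates φ u₂ X.1 (φ X.1 b * X.2⁻¹) r₂ ∧ g = g₁ * φ j b ∧ r = r₁ + r₂ := by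
  generalize hw : u ++ [X] = w at h
  induction h generalizing u with
  | nil => simp at hw
  | single i x =>
    obtain ⟨rfl, hX⟩ := List.append_inj' (hw.trans (List.nil_append _).symm) rfl
    obtain rfl := List.singleton_injective hX
    exact .inl ⟨x, rfl, by simpa using Evaluates.nil i⟩
  | @append w w' i g g' r r' hl hr ihl ihr =>
    rcases List.eq_nil_or_concat' w' with rfl | ⟨u', Y, rfl⟩
    · have h0 := dist_one_le_of_nil hG hagree hr
      rcases ihl (by simpa using hw) with
        ⟨y, rfl, h⟩ | ⟨u₁, u₂, b, g₁, r₁, r₂, rfl, h₁, h₂, rfl, rfl⟩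
      · refine .inl ⟨y, rfl, h.weaken ?_⟩
        rw [(hG i).dist_mul_mul_left]
        gcongr
      · refine .inr ⟨u₁, u₂, b, g₁ * φ i b * g' * (φ i b)⁻¹, r₁ + r', r₂, rfl,
          h₁.weaken ?_, h₂, by group, by ring⟩
        rw [← (hG i (φ i b) _ _).2, inv_mul_cancel_right, ← mul_one (g₁ * φ i b), mul_assoc _ 1,
          one_mul, (hG i _ _ _).1, dist_comm]
        gcongr
    · rw [← List.append_assoc] at hw
      obtain ⟨rfl, hX⟩ := List.append_inj' hw rfl
      obtain rfl := List.singleton_injective hX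
      rcases ihr rfl with ⟨y, rfl, h⟩ | ⟨u₁, u₂, b, g₁, r₁, r₂, rfl, h₁, h₂, rfl, rfl⟩
      · exact .inl ⟨y, rfl, (hl.append h).congr (by group) le_rfl⟩
      · exact .inr ⟨w ++ u₁, u₂, b, g * g₁, r + r₁, r₂, by simp, hl.append h₁, h₂,
          by group, by ring⟩
  | @move w i g g' r s h hs ih =>
    rcases ih hw with ⟨y, rfl, h⟩ | ⟨u₁, u₂, b, g₁, r₁, r₂, rfl, h₁, h₂, rfl, rfl⟩
    · exact .inl ⟨y, rfl, h.move (by rwa [(hG i _ _ _).2])⟩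
    · refine .inr ⟨u₁, u₂, b, g' * (φ i b)⁻¹, r₁ + s, r₂, rfl, h₁.move ?_, h₂, by group, by ring⟩
      rwa [← (hG i (φ i b) _ _).2, inv_mul_cancel_right]
  | @retag w i a r l h ih =>
    rcases ih hw with ⟨y, rfl, h⟩ | ⟨u₁, u₂, b, g₁, r₁, r₂, rfl, h₁, h₂, hg, rfl⟩
    · exact .inr ⟨[], u, a, 1, 0, r, by simp, .nil l, h, by simp, by simp⟩
    · obtain rfl : g₁ = φ i (a * b⁻¹) := by rw [map_mul, hg, map_inv]; group
      exact .inr ⟨u₁, u₂, b, φ l (a * b⁻¹), r₁, r₂, rfl, h₁.retag l, h₂, by simp, rfl⟩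

/-- Adjacent inverse letters can be cancelled without increasing the cost: the block in which the
first one ends and the block in which the second one begins are joined to one block. -/
theorem cancel (hG : ∀ i, IsTwoSidedInvariant (dist : G i → G i → ℝ))
    (hagree : ∀ i j, ∀ a b : A, dist (φ i a) (φ i b) = dist (φ j a) (φ j b))
    {k : Λ} {x : G k} {u v : List (Letter G)} {j : Λ} {g : G j} {r : ℝ}
    (h : Evaluates φ (u ++ ⟨k, x⟩ :: ⟨k, x⁻¹⟩ :: v) j g r) : Evaluates φ (u ++ v) j g r := by
  generalize hw : u ++ ⟨k, x⟩ :: ⟨k, x⁻¹⟩ :: v = w at h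
  induction h generalizing u v with
  | nil => simp at hw
  | single i y =>
    have := congrArg List.length hw
    simp at this
    omega
  | @append w w' i g g' r r' hl hr ihl ihr =>
    rcases List.append_eq_append_iff.1 hw with ⟨t, rfl, ht⟩ | ⟨t, rfl, rfl⟩
    · match t, ht with
      | [], ht => exact (hl.append (ihr (u := []) ht)).congr rfl le_rfl |> (by simpa using ·)
      | [_], ht =>
        obtain ⟨rfl, rfl⟩ := List.cons_eq_cons.1 ht
        rcases concat_cases hG hagree hl with
          ⟨y, hy, h⟩ | ⟨u₁, u₂, b, g₁, r₁, r₂, rfl, h₁, h₂, rfl, rfl⟩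
        · cases hy
          rcases cons_cases hG hagree hr with
            ⟨z, hz, h'⟩ | ⟨v₁, v₂, c, g₂, s₁, s₂, rfl, h₁, h₂, rfl, rfl⟩
          · cases hz
            exact (h.append h').congr (by group) le_rfl
          · have := (h.append h₁).append h₂
            rw [List.append_assoc] at this
            exact this.congr (by simp only [inv_inv]; group) (by linarith)
        · rcases cons_cases hG hagree hr with
            ⟨z, hz, h'⟩ | ⟨v₁, v₂, c, g₂, s₁, s₂, rfl, h₁', h₂', rfl, rfl⟩
          · cases hz
            have := h₁.append (h₂.append h')
            rw [← List.append_assoc] at this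
            exact this.congr (by simp only [inv_inv]; group) (by linarith)
          · have h3 : Evaluates φ (u₂ ++ v₁) k (φ k (b * c)) (r₂ + s₁) :=
              (h₂.append h₁').congr (by simp) le_rfl
            have := h₁.append ((h3.retag i).append h₂')
            rw [List.append_assoc, ← List.append_assoc u₁] at this
            exact (by simpa using this : Evaluates φ _ i _ _).congr
              (by simp [mul_assoc]) (by linarith)
      | _ :: _ :: t, ht =>
        rw [List.cons_append, List.cons_append, List.cons.injEq, List.cons.injEq] at ht
        obtain ⟨rfl, rfl, rfl⟩ := ht
        rw [← List.append_assoc]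
        exact (ihl rfl).append hr
    · rw [List.append_assoc]
      exact hl.append (ihr rfl)
  | move _ hs ih => exact (ih hw).move hs
  | retag l _ ih => exact (ih hw).retag l

/-- A letter may be replaced by a word that evaluates to it without error. -/
theorem subst {w' : List (Letter G)} {k : Λ} {x : G k} (hw' : Evaluates φ w' k x 0)
    {u v : List (Letter G)} {j : Λ} {g : G j} {r : ℝ}
    (h : Evaluates φ (u ++ ⟨k, x⟩ :: v) j g r) : Evaluates φ (u ++ (w' ++ v)) j g r := by
  generalize hw : u ++ ⟨k, x⟩ :: v = w at h
  induction h generalizing u v with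
  | nil => simp at hw
  | single i y =>
    rcases List.append_eq_singleton_iff.1 hw with ⟨rfl, h⟩ | ⟨-, h⟩
    · cases h
      simpa using hw'
    · simp at h
  | @append w w₂ i g g' r r' hl hr ihl ihr =>
    rcases List.append_eq_append_iff.1 hw with ⟨t, rfl, ht⟩ | ⟨t, rfl, rfl⟩
    · match t, ht with
      | [], ht => simpa using hl.append (ihr (u := []) ht)
      | _ :: t, ht =>
        rw [List.cons_append, List.cons.injEq] at ht
        obtain ⟨rfl, rfl⟩ := ht
        simpa using (ihl rfl).append hr
    · rw [List.append_assoc]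
      exact hl.append (ihr rfl)
  | move _ hs ih => exact (ih hw).move hs
  | retag l _ ih => exact (ih hw).retag l

/-- A letter `1` may be inserted anywhere. -/
theorem insert_one (k : Λ) {u v : List (Letter G)} {j : Λ} {g : G j} {r : ℝ}
    (h : Evaluates φ (u ++ v) j g r) : Evaluates φ (u ++ ⟨k, 1⟩ :: v) j g r := by
  have h1 : ∀ i, Evaluates φ [⟨k, 1⟩] i 1 0 := (single k 1).retag_one
  generalize hw : u ++ v = w at h
  induction h generalizing u v with
  | nil i =>
    obtain ⟨rfl, rfl⟩ := List.append_eq_nil_iff.1 hw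
    exact h1 i
  | single i y =>
    rcases List.append_eq_singleton_iff.1 hw with ⟨rfl, rfl⟩ | ⟨rfl, rfl⟩
    · simpa using (h1 i).append (single i y)
    · simpa using (single i y).append (h1 i)
  | @append w w₂ i g g' r r' hl hr ihl ihr =>
    rcases List.append_eq_append_iff.1 hw with ⟨t, rfl, rfl⟩ | ⟨t, rfl, rfl⟩
    · simpa using (ihl rfl).append hr
    · simpa using hl.append (ihr rfl)
  | move _ hs ih => exact (ih hw).move hs
  | retag l _ ih => exact (ih hw).retag l

end Evaluates

/-! ### The cost depends only on the element of the amalgam -/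

/-- Two words are equivalent if they can be exchanged in all evaluations. -/
def evaluationCon (φ : ∀ i, A →* G i) : Con (FreeMonoid (Letter G)) where
  r w w' := ∀ (u v : List (Letter G)) (i : Λ) (g : G i) (r : ℝ),
    Evaluates φ (u ++ (w.toList ++ v)) i g r ↔ Evaluates φ (u ++ (w'.toList ++ v)) i g r
  iseqv := ⟨fun _ _ _ _ _ _ => Iff.rfl, fun h u v i g r => (h u v i g r).symm,
    fun h h' u v i g r => (h u v i g r).trans (h' u v i g r)⟩
  mul' {w x y z} h h' u v i g r := by
    have e := h u (y.toList ++ v) i g r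
    have e' := h' (u ++ x.toList) v i g r
    simp only [FreeMonoid.toList_mul, List.append_assoc] at e e' ⊢
    exact e.trans e'

/-- The homomorphism from a factor to the monoid of words modulo exchangeability. -/
def factorToQuotient (hG : ∀ i, IsTwoSidedInvariant (dist : G i → G i → ℝ))
    (hagree : ∀ i j, ∀ a b : A, dist (φ i a) (φ i b) = dist (φ j a) (φ j b)) (i : Λ) :
    G i →* (evaluationCon φ).Quotient where
  toFun x := (FreeMonoid.of (⟨i, x⟩ : Letter G) : FreeMonoid (Letter G))
  map_one' := (Con.eq _).2 fun _ _ _ _ _ =>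
    ⟨Evaluates.subst (.nil i), Evaluates.insert_one i⟩
  map_mul' x y := (Con.eq _).2 fun u v _ _ _ =>
    ⟨Evaluates.subst ((Evaluates.single i x).append (.single i y) |>.congr rfl (by simp)),
      fun h => by
        -- replace `x` by `(x * y) * y⁻¹` and cancel `y⁻¹` against the letter `y`
        have hx : Evaluates φ [⟨i, x * y⟩, ⟨i, y⁻¹⟩] i x 0 :=
          ((Evaluates.single i (x * y)).append (.single i y⁻¹)).congr (by group) (by simp)
        have h' := hx.subst (u := u) (v := ⟨i, y⟩ :: v) h
        have := Evaluates.cancel hG hagree (k := i) (x := y⁻¹) (u := u ++ [⟨i, x * y⟩]) (v := v)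
          (by simpa using h')
        simpa using this⟩

theorem factorToQuotient_agree (hG : ∀ i, IsTwoSidedInvariant (dist : G i → G i → ℝ))
    (hagree : ∀ i j, ∀ a b : A, dist (φ i a) (φ i b) = dist (φ j a) (φ j b)) (i j : Λ) (a : A) :
    factorToQuotient hG hagree i (φ i a) = factorToQuotient hG hagree j (φ j a) :=
  (Con.eq _).2 fun _ _ _ _ _ =>
    ⟨Evaluates.subst ((Evaluates.single j (φ j a)).retag i),
      Evaluates.subst ((Evaluates.single i (φ i a)).retag j)⟩

/-- Words with the same value in the amalgam have the same evaluations: the cost of an evaluation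
descends to the amalgam. -/
theorem Evaluates.of_wordVal_eq (hG : ∀ i, IsTwoSidedInvariant (dist : G i → G i → ℝ))
    (hagree : ∀ i j, ∀ a b : A, dist (φ i a) (φ i b) = dist (φ j a) (φ j b))
    {w w' : List (Letter G)} (hw : wordVal φ w = wordVal φ w') {i : Λ} {g : G i} {r : ℝ}
    (h : Evaluates φ w i g r) : Evaluates φ w' i g r := by
  let F : PushoutI φ →* (evaluationCon φ).Quotient :=
    PushoutI.lift (factorToQuotient hG hagree) ((factorToQuotient hG hagree i).comp (φ i))
      fun j => MonoidHom.ext fun a => factorToQuotient_agree hG hagree j i a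
  have key : ∀ w : List (Letter G),
      F (wordVal φ w) = (FreeMonoid.ofList w : FreeMonoid (Letter G)) := by
    intro w
    induction w with
    | nil => exact map_one F
    | cons X w ih =>
      rw [wordVal, List.map_cons, List.prod_cons, map_mul, ← wordVal, ih, letterVal,
        PushoutI.lift_of]
      rfl
  have := (Con.eq _).1 ((key w).symm.trans ((congrArg F hw).trans (key w'))) [] [] i g r
  simpa using this.1 (by simpa using h)

end Evaluation

/-! ### Elementary properties of the Graev distance -/

section GraevDistance

variable {A : Type*} [Group A] {Λ : Type*} {G : Λ → Type*} [∀ i, Group (G i)]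
  {φ : ∀ i, A →* G i}

theorem wordVal_nil : wordVal φ [] = 1 := rfl

theorem wordVal_cons (X : Letter G) (w : List (Letter G)) :
    wordVal φ (X :: w) = PushoutI.of X.1 X.2 * wordVal φ w := by
  simp [wordVal, letterVal]

theorem wordVal_append (w w' : List (Letter G)) :
    wordVal φ (w ++ w') = wordVal φ w * wordVal φ w' := by
  simp [wordVal]

theorem wordVal_replicate_one (i : Λ) (n : ℕ) :
    wordVal φ (List.replicate n (⟨i, 1⟩ : Letter G)) = 1 := by
  induction n with
  | zero => rfl
  | succ n ih => rw [List.replicate_succ, wordVal_cons, ih, map_one, one_mul]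

theorem of_apply_agree (i j : Λ) (a : A) :
    (PushoutI.of i (φ i a) : PushoutI φ) = PushoutI.of j (φ j a) := by
  rw [PushoutI.of_apply_eq_base, PushoutI.of_apply_eq_base]

theorem wordVal_surjective [Nonempty Λ] : Function.Surjective (wordVal φ) := by
  intro f
  induction f using PushoutI.induction_on with
  | of i x => exact ⟨[⟨i, x⟩], by simp [wordVal, letterVal]⟩
  | base a =>
    obtain ⟨i⟩ := ‹Nonempty Λ›
    exact ⟨[⟨i, φ i a⟩], by simp [wordVal, letterVal, PushoutI.of_apply_eq_base]⟩
  | mul f g hf hg =>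
    obtain ⟨w, rfl⟩ := hf
    obtain ⟨w', rfl⟩ := hg
    exact ⟨w ++ w', wordVal_append w w'⟩

variable [∀ i, MetricSpace (G i)]

theorem letterDist_nonneg (X Y : Letter G) : 0 ≤ letterDist φ X Y := by
  unfold letterDist
  split
  · exact dist_nonneg
  · exact Real.iInf_nonneg fun a => add_nonneg dist_nonneg dist_nonneg

theorem letterDist_comm (X Y : Letter G) : letterDist φ X Y = letterDist φ Y X := by
  obtain ⟨i, x⟩ := X
  obtain ⟨j, y⟩ := Y
  by_cases h : i = j
  · subst h
    rw [letterDist_same, letterDist_same, dist_comm]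
  · rw [letterDist_of_ne φ h, letterDist_of_ne φ (Ne.symm h)]
    simp only [dist_comm, add_comm]

theorem letterDist_self (X : Letter G) : letterDist φ X X = 0 := by
  obtain ⟨i, x⟩ := X
  rw [letterDist_same, dist_self]

theorem letterDist_le_add (i j : Λ) (hij : i ≠ j) (x : G i) (y : G j) (a : A) :
    letterDist φ ⟨i, x⟩ ⟨j, y⟩ ≤ dist x (φ i a) + dist (φ j a) y := by
  rw [letterDist_of_ne φ hij]
  exact ciInf_le ⟨0, by rintro _ ⟨b, rfl⟩; exact add_nonneg dist_nonneg dist_nonneg⟩ a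

theorem wordDist_nonneg (α β : List (Letter G)) : 0 ≤ wordDist φ α β := by
  induction α generalizing β with
  | nil => simp [wordDist]
  | cons X α ih =>
    cases β with
    | nil => simp [wordDist]
    | cons Y β =>
      have := ih β
      simp only [wordDist, List.zipWith_cons_cons, List.sum_cons] at this ⊢
      exact add_nonneg (letterDist_nonneg X Y) this

theorem wordDist_comm (α β : List (Letter G)) : wordDist φ α β = wordDist φ β α := by
  rw [wordDist, List.zipWith_comm_of_comm letterDist_comm, wordDist]

theorem wordDist_self (α : List (Letter G)) : wordDist φ α α = 0 := by
  simp [wordDist, letterDist_self]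

theorem wordDist_append {α β α' β' : List (Letter G)} (h : α.length = β.length) :
    wordDist φ (α ++ α') (β ++ β') = wordDist φ α β + wordDist φ α' β' := by
  simp [wordDist, List.zipWith_append h]

theorem graevDist_bddBelow (f g : PushoutI φ) :
    BddBelow {r | ∃ α β : List (Letter G), α ≠ [] ∧ α.length = β.length ∧
      wordVal φ α = f ∧ wordVal φ β = g ∧ wordDist φ α β = r} := by
  refine ⟨0, ?_⟩
  rintro _ ⟨α, β, -, -, -, -, rfl⟩
  exact wordDist_nonneg α β

theorem graevDist_nonneg (f g : PushoutI φ) : 0 ≤ graevDist φ f g := by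
  refine Real.sInf_nonneg ?_
  rintro _ ⟨α, β, -, -, -, -, rfl⟩
  exact wordDist_nonneg α β

theorem graevDist_le_wordDist {α β : List (Letter G)} (h0 : α ≠ []) (h : α.length = β.length) :
    graevDist φ (wordVal φ α) (wordVal φ β) ≤ wordDist φ α β :=
  csInf_le (graevDist_bddBelow _ _) ⟨α, β, h0, h, rfl, rfl, rfl⟩

theorem graevDist_letterVal_le (X Y : Letter G) :
    graevDist φ (letterVal φ X) (letterVal φ Y) ≤ letterDist φ X Y := by
  simpa [wordVal, wordDist] using
    graevDist_le_wordDist (φ := φ) (α := [X]) (β := [Y]) (by simp) rfl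

theorem graevDist_of_le (i : Λ) (x y : G i) :
    graevDist φ (PushoutI.of i x) (PushoutI.of i y) ≤ dist x y := by
  simpa [letterVal, letterDist_same] using graevDist_letterVal_le (φ := φ) ⟨i, x⟩ ⟨i, y⟩

theorem graevDist_comm (f g : PushoutI φ) : graevDist φ f g = graevDist φ g f := by
  have : ∀ f g : PushoutI φ, {r | ∃ α β : List (Letter G), α ≠ [] ∧ α.length = β.length ∧
      wordVal φ α = f ∧ wordVal φ β = g ∧ wordDist φ α β = r} ⊆
      {r | ∃ α β : List (Letter G), α ≠ [] ∧ α.length = β.length ∧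
      wordVal φ α = g ∧ wordVal φ β = f ∧ wordDist φ α β = r} := by
    rintro f g _ ⟨α, β, h0, hl, hα, hβ, rfl⟩
    refine ⟨β, α, ?_, hl.symm, hβ, hα, wordDist_comm β α⟩
    rwa [← List.length_pos_iff, ← hl, List.length_pos_iff]
  exact congrArg sInf ((this f g).antisymm (this g f))

section Nonempty

variable [Nonempty Λ]

theorem exists_wordDist_lt {f g : PushoutI φ} {r : ℝ} (h : graevDist φ f g < r) :
    ∃ α β : List (Letter G), α ≠ [] ∧ α.length = β.length ∧
      wordVal φ α = f ∧ wordVal φ β = g ∧ wordDist φ α β < r := by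
  have hne : {r | ∃ α β : List (Letter G), α ≠ [] ∧ α.length = β.length ∧
      wordVal φ α = f ∧ wordVal φ β = g ∧ wordDist φ α β = r}.Nonempty := by
    obtain ⟨α, rfl⟩ := wordVal_surjective f
    obtain ⟨β, rfl⟩ := wordVal_surjective g
    obtain ⟨i⟩ := ‹Nonempty Λ›
    refine ⟨_, ⟨i, 1⟩ :: (α ++ List.replicate β.length ⟨i, 1⟩),
      ⟨i, 1⟩ :: (List.replicate α.length ⟨i, 1⟩ ++ β), by simp, by simp, ?_, ?_, rfl⟩ <;>
    simp [wordVal_cons, wordVal_append, wordVal_replicate_one]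
  obtain ⟨_, ⟨α, β, h0, hl, hα, hβ, rfl⟩, hr⟩ := exists_lt_of_csInf_lt hne h
  exact ⟨α, β, h0, hl, hα, hβ, hr⟩

theorem graevDist_mul_mul_le (f f' g g' : PushoutI φ) :
    graevDist φ (f * f') (g * g') ≤ graevDist φ f g + graevDist φ f' g' := by
  refine le_of_forall_pos_lt_add fun ε hε => ?_
  obtain ⟨α, β, h0, hl, rfl, rfl, h⟩ :=
    exists_wordDist_lt (lt_add_of_pos_right (graevDist φ f g) (half_pos hε))
  obtain ⟨α', β', h0', hl', rfl, rfl, h'⟩ :=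
    exists_wordDist_lt (lt_add_of_pos_right (graevDist φ f' g') (half_pos hε))
  have := graevDist_le_wordDist (φ := φ) (α := α ++ α') (β := β ++ β') (by simp [h0])
    (by simp [hl, hl'])
  rw [wordVal_append, wordVal_append, wordDist_append hl] at this
  linarith

theorem graevDist_self (f : PushoutI φ) : graevDist φ f f = 0 := by
  obtain ⟨w, rfl⟩ := wordVal_surjective f
  refine (graevDist_nonneg _ _).antisymm' ?_
  obtain ⟨i⟩ := ‹Nonempty Λ›
  have := graevDist_le_wordDist (φ := φ) (α := ⟨i, 1⟩ :: w) (β := ⟨i, 1⟩ :: w) (by simp) rfl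
  simpa [wordVal_cons, wordDist_self] using this

theorem graevDist_isTwoSidedInvariant : IsTwoSidedInvariant (graevDist φ) := by
  have hl : ∀ g f₁ f₂ : PushoutI φ, graevDist φ (g * f₁) (g * f₂) ≤ graevDist φ f₁ f₂ :=
    fun g f₁ f₂ => by simpa [graevDist_self] using graevDist_mul_mul_le g f₁ g f₂
  have hr : ∀ g f₁ f₂ : PushoutI φ, graevDist φ (f₁ * g) (f₂ * g) ≤ graevDist φ f₁ f₂ :=
    fun g f₁ f₂ => by simpa [graevDist_self] using graevDist_mul_mul_le f₁ g f₂ g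
  intro g f₁ f₂
  refine ⟨(hl g f₁ f₂).antisymm ?_, (hr g f₁ f₂).antisymm ?_⟩
  · simpa using hl g⁻¹ (g * f₁) (g * f₂)
  · simpa using hr g⁻¹ (f₁ * g) (f₂ * g)

theorem graevDist_triangle (f g h : PushoutI φ) :
    graevDist φ f h ≤ graevDist φ f g + graevDist φ g h := by
  calc graevDist φ f h = graevDist φ ((f * g⁻¹) * g) ((g * g⁻¹) * h) := by group
    _ ≤ graevDist φ (f * g⁻¹) (g * g⁻¹) + graevDist φ g h := graevDist_mul_mul_le _ _ _ _
    _ = _ := by rw [(graevDist_isTwoSidedInvariant g⁻¹ f g).2]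

theorem graevDist_mul_inv_one (f g : PushoutI φ) :
    graevDist φ (f * g⁻¹) 1 = graevDist φ f g := by
  rw [← (graevDist_isTwoSidedInvariant g (f * g⁻¹) 1).2, inv_mul_cancel_right, one_mul]

end Nonempty

/-! ### The Graev distance as the cost of evaluations -/

/-- The evaluations of an element of the amalgam: those of any word that represents it, see
`Evaluates.of_wordVal_eq`. -/
def EvaluatesAt (φ : ∀ i, A →* G i) (f : PushoutI φ) (i : Λ) (g : G i) (r : ℝ) : Prop :=
  ∃ w, wordVal φ w = f ∧ Evaluates φ w i g r

namespace EvaluatesAt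

theorem mul {f f' : PushoutI φ} {i : Λ} {g g' : G i} {r r' : ℝ} (h : EvaluatesAt φ f i g r)
    (h' : EvaluatesAt φ f' i g' r') : EvaluatesAt φ (f * f') i (g * g') (r + r') := by
  obtain ⟨w, rfl, h⟩ := h
  obtain ⟨w', rfl, h'⟩ := h'
  exact ⟨w ++ w', wordVal_append w w', h.append h'⟩

theorem conj {f : PushoutI φ} {i : Λ} {r : ℝ} (h : EvaluatesAt φ f i 1 r) (j : Λ) (y : G j) :
    EvaluatesAt φ (PushoutI.of j y * f * (PushoutI.of j y)⁻¹) i 1 r := by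
  obtain ⟨w, rfl, h⟩ := h
  refine ⟨[⟨j, y⟩] ++ w ++ [⟨j, y⁻¹⟩], ?_, ?_⟩
  · simp [wordVal_append, wordVal_cons, wordVal_nil, mul_assoc]
  · exact ((((Evaluates.single j y).append (h.retag_one j)).append (.single j y⁻¹)).congr
      (by group) (by simp)).retag_one i

theorem of_letterDist_lt (hG : ∀ i, IsTwoSidedInvariant (dist : G i → G i → ℝ))
    {X Y : Letter G} {r : ℝ} (h : letterDist φ X Y < r) (k : Λ) :
    EvaluatesAt φ (PushoutI.of X.1 X.2 * (PushoutI.of Y.1 Y.2)⁻¹) k 1 r := by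
  obtain ⟨i, x⟩ := X
  obtain ⟨j, y⟩ := Y
  refine ⟨[⟨i, x⟩, ⟨j, y⁻¹⟩], by simp [wordVal_cons, wordVal_nil], ?_⟩
  refine Evaluates.retag_one (i := j) ?_ k
  by_cases hij : i = j
  · subst hij
    rw [letterDist_same] at h
    refine ((Evaluates.single i x).append (.single i y⁻¹)).weaken ?_
    rw [(hG i).dist_mul_inv_one]
    linarith
  · rw [letterDist_of_ne φ hij] at h
    obtain ⟨a, ha⟩ := exists_lt_of_ciInf_lt h
    -- move `x` to `a`, regard `a` as an element of the factor of `y`, and move `a` to `y`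
    have h1 : Evaluates φ [⟨i, x⟩] i (φ i a) (dist x (φ i a)) :=
      (Evaluates.single i x).weaken (by simp)
    refine ((h1.retag j).append (.single j y⁻¹)).weaken ?_
    rw [(hG j).dist_mul_inv_one]
    linarith

end EvaluatesAt

section Nonempty

variable [Nonempty Λ]

theorem Evaluates.graevDist_le {w : List (Letter G)} {i : Λ} {g : G i} {r : ℝ}
    (h : Evaluates φ w i g r) : graevDist φ (wordVal φ w) (PushoutI.of i g) ≤ r := by
  induction h with
  | nil i => rw [wordVal_nil, map_one, graevDist_self]
  | single i x => rw [wordVal_cons, wordVal_nil, mul_one, graevDist_self]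
  | append _ _ h h' =>
    rw [wordVal_append, map_mul]
    exact (graevDist_mul_mul_le _ _ _ _).trans (add_le_add h h')
  | move _ hs h =>
    exact (graevDist_triangle _ _ _).trans (add_le_add h ((graevDist_of_le _ _ _).trans hs))
  | retag j _ h => rwa [of_apply_agree _ j] at h

namespace EvaluatesAt

theorem of_graevDist_lt (hG : ∀ i, IsTwoSidedInvariant (dist : G i → G i → ℝ))
    {f g : PushoutI φ} {r : ℝ} (h : graevDist φ f g < r) (i : Λ) :
    EvaluatesAt φ (f * g⁻¹) i 1 r := by
  obtain ⟨α, β, -, hl, rfl, rfl, hr⟩ := exists_wordDist_lt h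
  clear h
  induction α generalizing β r with
  | nil =>
    obtain rfl := List.length_eq_zero_iff.1 hl.symm
    replace hr : 0 < r := by simpa [wordDist] using hr
    exact ⟨[], by simp [wordVal_nil], (Evaluates.nil i).congr rfl hr.le⟩
  | cons X α ih =>
    cases β with
    | nil => simp at hl
    | cons Y β =>
      have hsum : wordDist φ (X :: α) (Y :: β) = letterDist φ X Y + wordDist φ α β := by
        simp [wordDist]
      -- `x α β⁻¹ y⁻¹` is the product of `x y⁻¹` and a conjugate of `α β⁻¹`
      have h1 := of_letterDist_lt (φ := φ) hG (X := X) (Y := Y)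
        (r := r - (wordDist φ α β + (r - wordDist φ (X :: α) (Y :: β)) / 2)) (by linarith) i
      have h2 := ih (β := β) (r := wordDist φ α β + (r - wordDist φ (X :: α) (Y :: β)) / 2)
        (by simpa using hl) (by linarith)
      have := h1.mul (h2.conj Y.1 Y.2)
      rw [one_mul, sub_add_cancel] at this
      rw [wordVal_cons, wordVal_cons]
      convert this using 1
      group

end EvaluatesAt

theorem Evaluates.of_graevDist_lt (hG : ∀ i, IsTwoSidedInvariant (dist : G i → G i → ℝ))
    (hagree : ∀ i j, ∀ a b : A, dist (φ i a) (φ i b) = dist (φ j a) (φ j b))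
    {w : List (Letter G)} {i : Λ} {g : G i} {r : ℝ}
    (h : graevDist φ (wordVal φ w) (PushoutI.of i g) < r) : Evaluates φ w i g r := by
  obtain ⟨w', hw', h'⟩ := (EvaluatesAt.of_graevDist_lt hG h i).mul
    (f' := PushoutI.of i g) ⟨[⟨i, g⟩], by simp [wordVal_cons, wordVal_nil], .single i g⟩
  refine (h'.of_wordVal_eq hG hagree ?_).congr (one_mul g) (add_zero r).le
  rw [hw', inv_mul_cancel_right]

end Nonempty

/-- The only evaluations of a single letter are the direct one and those through `A`. -/
theorem Evaluates.singleton_cases (hG : ∀ i, IsTwoSidedInvariant (dist : G i → G i → ℝ))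
    (hagree : ∀ i j, ∀ a b : A, dist (φ i a) (φ i b) = dist (φ j a) (φ j b))
    {X : Letter G} {j : Λ} {g : G j} {r : ℝ} (h : Evaluates φ [X] j g r) :
    (∃ x : G j, X = ⟨j, x⟩ ∧ dist x g ≤ r) ∨
      ∃ a, dist X.2 (φ X.1 a) + dist (φ j a) g ≤ r := by
  generalize hw : [X] = w at h
  induction h with
  | nil => simp at hw
  | single i x =>
    obtain rfl := List.singleton_injective hw
    exact .inl ⟨x, rfl, by simp⟩
  | @append w w' i g g' r r' hl hr ihl ihr =>
    rcases List.append_eq_singleton_iff.1 hw.symm with ⟨rfl, rfl⟩ | ⟨rfl, rfl⟩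
    · have h0 := dist_one_le_of_nil hG hagree hl
      have h1 : dist g' (g * g') ≤ r := by
        simpa [dist_comm] using (hG i g' g 1).2.le.trans h0
      rcases ihr rfl with ⟨x, rfl, h⟩ | ⟨a, h⟩
      · exact .inl ⟨x, rfl, by linarith [dist_triangle x g' (g * g')]⟩
      · exact .inr ⟨a, by linarith [dist_triangle (φ i a) g' (g * g')]⟩
    · have h0 := dist_one_le_of_nil hG hagree hr
      have h1 : dist g (g * g') ≤ r' := by
        simpa [dist_comm] using (hG i g g' 1).1.le.trans h0
      rcases ihl rfl with ⟨x, rfl, h⟩ | ⟨a, h⟩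
      · exact .inl ⟨x, rfl, by linarith [dist_triangle x g (g * g')]⟩
      · exact .inr ⟨a, by linarith [dist_triangle (φ i a) g (g * g')]⟩
  | @move w i g g' r s h hs ih =>
    rcases ih hw with ⟨x, rfl, h⟩ | ⟨a, h⟩
    · exact .inl ⟨x, rfl, by linarith [dist_triangle x g g']⟩
    · exact .inr ⟨a, by linarith [dist_triangle (φ i a) g g']⟩
  | @retag w i a r l h ih =>
    rcases ih hw with ⟨x, rfl, h⟩ | ⟨b, h⟩
    · exact .inr ⟨a, by simpa using h⟩
    · exact .inr ⟨b, by rwa [hagree l i]⟩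

theorem Evaluates.letterDist_le (hG : ∀ i, IsTwoSidedInvariant (dist : G i → G i → ℝ))
    (hagree : ∀ i j, ∀ a b : A, dist (φ i a) (φ i b) = dist (φ j a) (φ j b))
    {X Y : Letter G} {r : ℝ} (h : Evaluates φ [X] Y.1 Y.2 r) : letterDist φ X Y ≤ r := by
  obtain ⟨i, x⟩ := X
  obtain ⟨j, y⟩ := Y
  rcases h.singleton_cases hG hagree with ⟨z, hz, h⟩ | ⟨a, h⟩
  · cases hz
    rwa [letterDist_same]
  · by_cases hij : i = j
    · subst hij
      rw [letterDist_same]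
      exact (dist_triangle _ _ _).trans h
    · exact (letterDist_le_add i j hij x y a).trans h

/-- The Graev distance extends the amalgam metric. -/
theorem graevDist_letterVal [Nonempty Λ]
    (hG : ∀ i, IsTwoSidedInvariant (dist : G i → G i → ℝ))
    (hagree : ∀ i j, ∀ a b : A, dist (φ i a) (φ i b) = dist (φ j a) (φ j b)) (X Y : Letter G) :
    graevDist φ (letterVal φ X) (letterVal φ Y) = letterDist φ X Y := by
  refine (graevDist_letterVal_le X Y).antisymm (le_of_forall_gt fun r hr => ?_)
  obtain ⟨s, hs, hsr⟩ := exists_between hr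
  have : Evaluates φ [X] Y.1 Y.2 s :=
    Evaluates.of_graevDist_lt hG hagree (by rwa [wordVal_cons, wordVal_nil, mul_one])
  exact (this.letterDist_le hG hagree).trans_lt hsr

theorem graevDist_of [Nonempty Λ] (hG : ∀ i, IsTwoSidedInvariant (dist : G i → G i → ℝ))
    (hagree : ∀ i j, ∀ a b : A, dist (φ i a) (φ i b) = dist (φ j a) (φ j b)) (i : Λ) (x y : G i) :
    graevDist φ (PushoutI.of i x) (PushoutI.of i y) = dist x y := by
  rw [← letterDist_same φ i x y, ← graevDist_letterVal hG hagree]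
  rfl

end GraevDistance

/-! ### Amalgams of subgroups -/

section Subgroups

variable {A : Type*} [Group A] {Λ : Type*} {G : Λ → Type*} [∀ i, Group (G i)]
  {φ : ∀ i, A →* G i} {H : ∀ i, Subgroup (G i)} {hH : ∀ i, (φ i).range ≤ H i}

/-- A letter from one of the subgroups `H i`, regarded as a letter from `G i`. -/
def inclLetter (H : ∀ i, Subgroup (G i)) (X : Letter fun i => H i) : Letter G := ⟨X.1, X.2⟩

theorem amalgamInclusion_of (i : Λ) (x : H i) :
    amalgamInclusion φ H hH (PushoutI.of i x) = PushoutI.of i (x : G i) := by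
  have hf : ∀ i, ((PushoutI.of i).comp (H i).subtype).comp (embedSub φ H hH i) =
      PushoutI.base φ := fun i => PushoutI.of_comp_eq_base i
  exact PushoutI.lift_of (fun i => (PushoutI.of i).comp (H i).subtype) (PushoutI.base φ) hf x

theorem amalgamInclusion_wordVal (w : List (Letter fun i => H i)) :
    amalgamInclusion φ H hH (wordVal _ w) = wordVal φ (w.map (inclLetter H)) := by
  induction w with
  | nil => simp [wordVal_nil]
  | cons X w ih =>
    rw [List.map_cons, wordVal_cons, wordVal_cons, map_mul, ih, amalgamInclusion_of]
    rfl

variable [∀ i, MetricSpace (G i)]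

theorem IsTwoSidedInvariant.subgroup {K : Type*} [Group K] [MetricSpace K]
    (h : IsTwoSidedInvariant (dist : K → K → ℝ)) (L : Subgroup K) :
    IsTwoSidedInvariant (dist : L → L → ℝ) :=
  fun g x y => h g x y

theorem isClosed_range_embedSub (hclosed : ∀ i, IsClosed (Set.range (φ i))) (i : Λ) :
    IsClosed (Set.range (embedSub φ H hH i)) := by
  convert (hclosed i).preimage (continuous_subtype_val (p := fun x => x ∈ H i)) using 1
  ext x
  simp only [Set.mem_range, Set.mem_preimage]
  exact exists_congr fun a => Subtype.ext_iff

namespace Evaluates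

theorem map_inclLetter {w : List (Letter fun i => H i)} {i : Λ} {h : H i} {r : ℝ}
    (hw : Evaluates (embedSub φ H hH) w i h r) :
    Evaluates φ (w.map (inclLetter H)) i (h : G i) r := by
  induction hw with
  | nil i => exact .nil i
  | single i x => exact .single i (x : G i)
  | append _ _ ih ih' =>
    rw [List.map_append]
    exact ih.append ih'
  | move _ hs ih => exact ih.move hs
  | retag j _ ih => exact ih.retag j

/-- An evaluation of a word over subgroups can be followed inside the subgroups: errors that lead
out of the subgroups are postponed, since the only values that are passed on to another factor lie
in `A`. -/
theorem exists_subgroup (hG : ∀ i, IsTwoSidedInvariant (dist : G i → G i → ℝ))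
    {w : List (Letter fun i => H i)} {i : Λ} {g : G i} {r : ℝ}
    (hw : Evaluates φ (w.map (inclLetter H)) i g r) :
    ∃ (h : H i) (s : ℝ), Evaluates (embedSub φ H hH) w i h s ∧ s + dist (h : G i) g ≤ r := by
  generalize hw' : w.map (inclLetter H) = w' at hw
  induction hw generalizing w with
  | nil i =>
    obtain rfl := List.map_eq_nil_iff.1 hw'
    exact ⟨1, 0, .nil i, by simp⟩
  | single i x =>
    obtain ⟨⟨j, y⟩, rfl, h⟩ := List.map_eq_singleton_iff.1 hw'
    cases h
    exact ⟨y, 0, Evaluates.single (G := fun i => H i) j y, by simp⟩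
  | @append w₁ w₂ i g g' r r' _ _ ih ih' =>
    obtain ⟨v₁, v₂, rfl, h₁, h₂⟩ := List.map_eq_append_iff.1 hw'
    obtain ⟨h, s, hs, hr⟩ := ih h₁
    obtain ⟨h', s', hs', hr'⟩ := ih' h₂
    have := (hG i).dist_mul_mul_le (h : G i) h' g g'
    exact ⟨h * h', s + s', hs.append hs', by push_cast; linarith⟩
  | @move w i g g' r t _ ht ih =>
    obtain ⟨h, s, hs, hr⟩ := ih hw'
    exact ⟨h, s, hs, by linarith [dist_triangle (h : G i) g g']⟩
  | @retag w i a r j _ ih =>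
    obtain ⟨h, s, hs, hr⟩ := ih hw'
    have : Evaluates (embedSub φ H hH) _ i (embedSub φ H hH i a) r := hs.weaken hr
    exact ⟨embedSub φ H hH j a, r, this.retag j, by simp [embedSub]⟩

end Evaluates

/-- The natural homomorphism between the amalgams preserves the Graev distances. -/
theorem graevDist_amalgamInclusion [Nonempty Λ]
    (hG : ∀ i, IsTwoSidedInvariant (dist : G i → G i → ℝ))
    (hagree : ∀ i j, ∀ a b : A, dist (φ i a) (φ i b) = dist (φ j a) (φ j b))
    (f g : PushoutI (embedSub φ H hH)) :
    graevDist (embedSub φ H hH) f g =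
      graevDist φ (amalgamInclusion φ H hH f) (amalgamInclusion φ H hH g) := by
  have i : Λ := Classical.arbitrary Λ
  refine le_antisymm (le_of_forall_gt fun r hr => ?_) (le_of_forall_gt fun r hr => ?_)
  · obtain ⟨s, hs, hsr⟩ := exists_between hr
    obtain ⟨w, hw⟩ := wordVal_surjective (f * g⁻¹)
    rw [← graevDist_mul_inv_one, ← map_inv, ← map_mul, ← hw, amalgamInclusion_wordVal,
      ← map_one (PushoutI.of i)] at hs
    obtain ⟨h, t, ht, hts⟩ :=
      (Evaluates.of_graevDist_lt hG hagree hs).exists_subgroup (hH := hH) hG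
    have := (ht.weaken (g' := 1) hts).graevDist_le
    rw [hw, map_one, graevDist_mul_inv_one] at this
    exact this.trans_lt hsr
  · obtain ⟨s, hs, hsr⟩ := exists_between hr
    obtain ⟨w, hw, h⟩ := EvaluatesAt.of_graevDist_lt (fun i => (hG i).subgroup (H i)) hs i
    have := h.map_inclLetter.graevDist_le
    rw [← amalgamInclusion_wordVal (hH := hH), hw, map_mul, map_inv, OneMemClass.coe_one, map_one,
      graevDist_mul_inv_one] at this
    exact this.trans_lt hsr

/-! ### Reduced words -/

namespace Evaluates

/-- A reduced word whose letters have distance at least `ε` from `A` has only evaluations of cost at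
least `ε`, unless it is a single letter. -/
theorem reduced_cases (hG : ∀ i, IsTwoSidedInvariant (dist : G i → G i → ℝ))
    (hagree : ∀ i j, ∀ a b : A, dist (φ i a) (φ i b) = dist (φ j a) (φ j b))
    {ε : ℝ} {w : List (Letter G)} {i : Λ} {g : G i} {r : ℝ} (h : Evaluates φ w i g r)
    (hw : w.IsChain fun X Y => X.1 ≠ Y.1) (hA : ∀ X ∈ w, ∀ a, ε ≤ dist X.2 (φ X.1 a))
    (h0 : w ≠ []) : ε ≤ r ∨ ∃ x : G i, w = [⟨i, x⟩] ∧ dist x g ≤ r := by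
  induction h with
  | nil => exact absurd rfl h0
  | single i x => exact .inr ⟨x, rfl, by simp⟩
  | @append w w' i g g' r r' hl hr ih ih' =>
    rcases eq_or_ne w [] with rfl | hne
    · have h1 : dist g' (g * g') ≤ r := by
        simpa [dist_comm] using (hG i g' g 1).2.le.trans (dist_one_le_of_nil hG hagree hl)
      rcases ih' hw hA h0 with h | ⟨x, rfl, h⟩
      · exact .inl (h.trans (le_add_of_nonneg_left hl.nonneg))
      · exact .inr ⟨x, rfl, by linarith [dist_triangle x g' (g * g')]⟩
    rcases eq_or_ne w' [] with rfl | hne'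
    · have h1 : dist g (g * g') ≤ r' := by
        simpa [dist_comm] using (hG i g g' 1).1.le.trans (dist_one_le_of_nil hG hagree hr)
      rw [List.append_nil] at hw hA ⊢
      rcases ih hw hA hne with h | ⟨x, rfl, h⟩
      · exact .inl (h.trans (le_add_of_nonneg_right hr.nonneg))
      · exact .inr ⟨x, rfl, by linarith [dist_triangle x g (g * g')]⟩
    have hA₁ : ∀ X ∈ w, ∀ a, ε ≤ dist X.2 (φ X.1 a) :=
      fun X hX => hA X (List.mem_append_left _ hX)
    have hA₂ : ∀ X ∈ w', ∀ a, ε ≤ dist X.2 (φ X.1 a) :=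
      fun X hX => hA X (List.mem_append_right _ hX)
    rcases ih hw.left_of_append hA₁ hne with h | ⟨x, rfl, -⟩
    · exact .inl (h.trans (le_add_of_nonneg_right hr.nonneg))
    rcases ih' hw.right_of_append hA₂ hne' with h | ⟨y, rfl, -⟩
    · exact .inl (h.trans (le_add_of_nonneg_left hl.nonneg))
    simp at hw
  | @move w i g g' r s h hs ih =>
    rcases ih hw hA h0 with h | ⟨x, rfl, h⟩
    · exact .inl (h.trans (le_add_of_nonneg_right (dist_nonneg.trans hs)))
    · exact .inr ⟨x, rfl, by linarith [dist_triangle x g g']⟩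
  | @retag w i a r j h ih =>
    rcases ih hw hA h0 with h | ⟨x, rfl, hx⟩
    · exact .inl h
    · exact .inl ((hA ⟨i, x⟩ (by simp) a).trans hx)

/-- The same for a reduced word preceded by a word over the subgroups `H i`, if the first letter of
the reduced word has distance at least `ε` from its subgroup. -/
theorem subgroup_append_reduced_cases (hG : ∀ i, IsTwoSidedInvariant (dist : G i → G i → ℝ))
    (hagree : ∀ i j, ∀ a b : A, dist (φ i a) (φ i b) = dist (φ j a) (φ j b))
    (hH : ∀ i, (φ i).range ≤ H i)
    {ε : ℝ} {v : List (Letter fun i => H i)} {X : Letter G} {w : List (Letter G)} {i : Λ} {g : G i}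
    {r : ℝ} (h : Evaluates φ (v.map (inclLetter H) ++ X :: w) i g r)
    (hw : (X :: w).IsChain fun X Y => X.1 ≠ Y.1)
    (hA : ∀ Y ∈ w, ∀ a, ε ≤ dist Y.2 (φ Y.1 a)) (hX : ∀ y ∈ H X.1, ε ≤ dist X.2 y) :
    ε ≤ r ∨ ∃ x : G i, w = [] ∧ X = ⟨i, x⟩ ∧ ∃ y ∈ H i, dist (y * x) g ≤ r := by
  generalize hl : v.map (inclLetter H) ++ X :: w = l at h
  induction h generalizing v w with
  | nil => simp at hl
  | single i x =>
    rcases List.append_eq_singleton_iff.1 hl with ⟨-, h⟩ | ⟨-, h⟩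
    · cases h
      exact .inr ⟨x, rfl, rfl, 1, one_mem _, by simp⟩
    · simp at h
  | @append l₁ l₂ i g g' r r' h₁ h₂ ih ih' =>
    -- if the left part is a word over the subgroups, it contributes a value close to `H i`
    have left : ∀ v₁ v₂ : List (Letter fun i => H i), v₁.map (inclLetter H) = l₁ →
        v₂.map (inclLetter H) ++ X :: w = l₂ →
        ε ≤ r + r' ∨ ∃ x : G i, w = [] ∧ X = ⟨i, x⟩ ∧ ∃ y ∈ H i, dist (y * x) (g * g') ≤ r + r' := by
      rintro v₁ v₂ rfl hl₂
      rcases ih' hw hA hl₂ with h | ⟨x, rfl, rfl, y, hy, h⟩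
      · exact .inl (h.trans (le_add_of_nonneg_left h₁.nonneg))
      · obtain ⟨z, s, hs, hz⟩ := h₁.exists_subgroup (hH := hH) hG
        refine .inr ⟨x, rfl, rfl, z * y, mul_mem z.2 hy, ?_⟩
        rw [mul_assoc]
        exact ((hG i).dist_mul_mul_le _ _ _ _).trans
          (add_le_add (by linarith [hs.nonneg]) h)
    rcases List.append_eq_append_iff.1 hl with ⟨t, rfl, ht⟩ | ⟨t, ht, rfl⟩
    · cases t with
      | nil => exact left v [] (by simp) (by simpa using ht)
      | cons Y t =>
        rw [List.cons_append, List.cons.injEq] at ht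
        obtain ⟨rfl, rfl⟩ := ht
        rcases ih (v := v) (w := t) (hw.left_of_append (l₁ := X :: t))
          (fun Y hY => hA Y (List.mem_append_left _ hY)) rfl with h | ⟨x, rfl, rfl, y, hy, h⟩
        · exact .inl (h.trans (le_add_of_nonneg_right h₂.nonneg))
        rw [List.nil_append] at hw hA ⊢
        rcases eq_or_ne l₂ [] with rfl | hne
        · refine .inr ⟨x, rfl, rfl, y, hy, ?_⟩
          have h1 : dist g (g * g') ≤ r' := by
            simpa [dist_comm] using (hG i g g' 1).1.le.trans (dist_one_le_of_nil hG hagree h₂)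
          linarith [dist_triangle (y * x) g (g * g')]
        · rcases h₂.reduced_cases hG hagree (ε := ε)
            (hw.right_of_append (l₁ := [⟨i, x⟩]))
            hA hne with h' | ⟨z, rfl, -⟩
          · exact .inl (h'.trans (le_add_of_nonneg_left h₁.nonneg))
          · simp at hw
    · obtain ⟨v₁, v₂, rfl, hv₁, rfl⟩ := List.map_eq_append_iff.1 ht
      exact left v₁ v₂ hv₁ rfl
  | @move l i g g' r s h hs ih =>
    rcases ih hw hA hl with h | ⟨x, rfl, rfl, y, hy, h⟩
    · exact .inl (h.trans (le_add_of_nonneg_right (dist_nonneg.trans hs)))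
    · exact .inr ⟨x, rfl, rfl, y, hy, by linarith [dist_triangle (y * x) g g']⟩
  | @retag l i a r j h ih =>
    rcases ih hw hA hl with h | ⟨x, rfl, rfl, y, hy, h⟩
    · exact .inl h
    · refine .inl ((hX (y⁻¹ * φ i a) (mul_mem (inv_mem hy) (hH i ⟨a, rfl⟩))).trans ?_)
      rwa [← (hG i y _ _).1, mul_inv_cancel_left]

end Evaluates

end Subgroups

/-! ### Positivity and closed subgroups -/

section Positivity

variable {A : Type*} [Group A] {Λ : Type*} {G : Λ → Type*} [∀ i, Group (G i)]
  {φ : ∀ i, A →* G i} {H : ∀ i, Subgroup (G i)}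

/-- Every element is a product of an element of the amalgam of the subgroups `H i` and a reduced
word whose first letter does not lie in its subgroup: a shortest word that represents the element
modulo the amalgam of the subgroups has this form. -/
theorem exists_subgroup_mul_reduced [Nonempty Λ] (hH : ∀ i, (φ i).range ≤ H i) (f : PushoutI φ) :
    ∃ (h : PushoutI (embedSub φ H hH)) (w : List (Letter G)),
      amalgamInclusion φ H hH h * wordVal φ w = f ∧ (w.IsChain fun X Y => X.1 ≠ Y.1) ∧
      (∀ X ∈ w, X.2 ∉ Set.range (φ X.1)) ∧ ∀ X ∈ w.head?, X.2 ∉ H X.1 := by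
  obtain ⟨w, ⟨h, hw⟩, hmin⟩ := (measure List.length).wf.has_min
    {w : List (Letter G) | ∃ h, amalgamInclusion φ H hH h * wordVal φ w = f} <| by
      obtain ⟨w, rfl⟩ := wordVal_surjective f
      exact ⟨w, 1, by simp⟩
  have hmin' : ∀ w' : List (Letter G), w'.length < w.length →
      ∀ h, amalgamInclusion φ H hH h * wordVal φ w' ≠ f := fun w' hlt h hf => hmin w' ⟨h, hf⟩ hlt
  have hhead : ∀ X ∈ w.head?, X.2 ∉ H X.1 := by
    intro X hX hXH
    obtain ⟨w', rfl⟩ : ∃ w', w = X :: w' := by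
      cases w with
      | nil => simp at hX
      | cons Y w' => exact ⟨w', by simpa using hX⟩
    refine hmin' w' (by simp)
      (h * PushoutI.of (G := fun i => H i) (φ := embedSub φ H hH) X.1 ⟨X.2, hXH⟩) ?_
    rw [map_mul, amalgamInclusion_of, mul_assoc, ← wordVal_cons, hw]
  refine ⟨h, w, hw, ?_, ?_, hhead⟩
  · -- adjacent letters from the same factor could be multiplied
    rw [List.isChain_iff_forall_rel_of_append_cons_cons]
    rintro ⟨i, x⟩ ⟨j, y⟩ l₁ l₂ rfl hij
    obtain rfl : i = j := hij
    refine hmin' (l₁ ++ ⟨i, x * y⟩ :: l₂) (by simp) h ?_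
    rw [← hw, wordVal_append, wordVal_append, wordVal_cons, wordVal_cons, wordVal_cons, map_mul,
      mul_assoc]
  · -- a letter from `A` could be absorbed by the letter before it
    rintro X hX ⟨a, ha⟩
    obtain ⟨l₁, l₂, rfl⟩ := List.append_of_mem hX
    rcases List.eq_nil_or_concat' l₁ with rfl | ⟨l, Z, rfl⟩
    · exact hhead X (by simp) (hH _ ⟨a, ha⟩)
    · refine hmin' (l ++ ⟨Z.1, Z.2 * φ Z.1 a⟩ :: l₂) (by simp) h ?_
      rw [← hw, wordVal_append, wordVal_append, wordVal_append, wordVal_cons, wordVal_cons,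
        wordVal_cons, wordVal_nil, map_mul, of_apply_agree Z.1 X.1, ha]
      group

variable [∀ i, MetricSpace (G i)]

theorem exists_pos_le_dist_of_notMem {X : Type*} [MetricSpace X] {S : Set X} (hS : IsClosed S)
    {x : X} (hx : x ∉ S) : ∃ ε > 0, ∀ y ∈ S, ε ≤ dist x y := by
  obtain ⟨ε, hε, hb⟩ := Metric.isOpen_iff.1 hS.isOpen_compl x hx
  exact ⟨ε, hε, fun y hy => not_lt.1 fun h => hb (by rwa [Metric.mem_ball, dist_comm]) hy⟩

/-- Finitely many letters outside `A` have a common positive lower bound for their distances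
from `A`. -/
theorem exists_pos_le_dist_of_forall_notMem_range
    (hclosed : ∀ i, IsClosed (Set.range (φ i))) (w : List (Letter G))
    (hw : ∀ X ∈ w, X.2 ∉ Set.range (φ X.1)) :
    ∃ ε > 0, ∀ X ∈ w, ∀ a, ε ≤ dist X.2 (φ X.1 a) := by
  induction w with
  | nil => exact ⟨1, one_pos, by simp⟩
  | cons X w ih =>
    obtain ⟨ε, hε, h⟩ := ih fun Y hY => hw Y (List.mem_cons_of_mem _ hY)
    obtain ⟨δ, hδ, h'⟩ := exists_pos_le_dist_of_notMem (hclosed X.1) (hw X (by simp))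
    refine ⟨min ε δ, lt_min hε hδ, fun Y hY a => ?_⟩
    rcases List.mem_cons.1 hY with rfl | hY
    · exact (min_le_right _ _).trans (h' _ ⟨a, rfl⟩)
    · exact (min_le_left _ _).trans (h Y hY a)

/-- An element outside the amalgam of closed subgroups has positive distance from it. -/
theorem exists_pos_le_graevDist [Nonempty Λ]
    (hG : ∀ i, IsTwoSidedInvariant (dist : G i → G i → ℝ))
    (hagree : ∀ i j, ∀ a b : A, dist (φ i a) (φ i b) = dist (φ j a) (φ j b))
    (hclosed : ∀ i, IsClosed (Set.range (φ i))) (hH : ∀ i, (φ i).range ≤ H i)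
    (hHc : ∀ i, IsClosed (H i : Set (G i))) {f : PushoutI φ}
    (hf : f ∉ Set.range (amalgamInclusion φ H hH)) :
    ∃ ε > 0, ∀ h, ε ≤ graevDist φ f (amalgamInclusion φ H hH h) := by
  obtain ⟨k, w, rfl, hchain, hA, hhead⟩ := exists_subgroup_mul_reduced hH f
  cases w with
  | nil => exact absurd ⟨k, by simp [wordVal_nil]⟩ hf
  | cons X w =>
    obtain ⟨ε, hε, h⟩ := exists_pos_le_dist_of_forall_notMem_range hclosed _ hA
    obtain ⟨δ, hδ, h'⟩ := exists_pos_le_dist_of_notMem (hHc X.1) (hhead X (by simp))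
    refine ⟨min ε δ, lt_min hε hδ, fun l => le_of_forall_gt fun r hr => ?_⟩
    obtain ⟨s, hs, hsr⟩ := exists_between hr
    obtain ⟨v, hv⟩ := wordVal_surjective (l⁻¹ * k)
    rw [← (graevDist_isTwoSidedInvariant (amalgamInclusion φ H hH l)⁻¹ _ _).1, inv_mul_cancel,
      ← mul_assoc, ← map_inv, ← map_mul, ← hv, amalgamInclusion_wordVal, ← wordVal_append,
      ← map_one (PushoutI.of X.1)] at hs
    refine lt_of_le_of_lt ?_ hsr
    rcases (Evaluates.of_graevDist_lt hG hagree hs).subgroup_append_reduced_cases hG hagree hH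
      (ε := min ε δ) hchain
      (fun Y hY a => (min_le_left _ _).trans (h Y (List.mem_cons_of_mem _ hY) a))
      (fun y hy => (min_le_right _ _).trans (h' y hy)) with h | ⟨x, -, hX, y, hy, hle⟩
    · exact h
    · refine (min_le_right _ _).trans ((h' y⁻¹ (inv_mem hy)).trans ?_)
      obtain rfl : X.2 = x := eq_of_heq (Sigma.mk.inj_iff.1 hX).2
      rwa [← (hG X.1 y _ _).1, mul_inv_cancel]

theorem eq_of_graevDist_eq_zero [Nonempty Λ]
    (hG : ∀ i, IsTwoSidedInvariant (dist : G i → G i → ℝ))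
    (hagree : ∀ i j, ∀ a b : A, dist (φ i a) (φ i b) = dist (φ j a) (φ j b))
    (hclosed : ∀ i, IsClosed (Set.range (φ i))) {f g : PushoutI φ} (h : graevDist φ f g = 0) :
    f = g := by
  have i : Λ := Classical.arbitrary Λ
  rw [← graevDist_mul_inv_one] at h
  rw [← mul_inv_eq_one]
  generalize f * g⁻¹ = k at h ⊢
  -- the amalgam of the subgroups `A` is `A`
  have hA : ∀ l : PushoutI (embedSub φ (fun i => (φ i).range) fun i => le_rfl),
      ∃ a, amalgamInclusion φ _ _ l = PushoutI.of i (φ i a) := by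
    intro l
    obtain ⟨w, rfl⟩ := wordVal_surjective l
    rw [amalgamInclusion_wordVal]
    induction w with
    | nil => exact ⟨1, by simp [wordVal_nil]⟩
    | cons X w ih =>
      obtain ⟨a, ha⟩ := ih
      obtain ⟨j, _, b, rfl⟩ := X
      refine ⟨b * a, ?_⟩
      rw [List.map_cons, wordVal_cons, ha, map_mul, map_mul, of_apply_agree i j b]
      rfl
  by_cases hk : k ∈ Set.range (amalgamInclusion φ (fun i => (φ i).range) fun i => le_rfl)
  · obtain ⟨l, rfl⟩ := hk
    obtain ⟨a, ha⟩ := hA l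
    rw [ha, ← map_one (PushoutI.of i), graevDist_of hG hagree] at h
    rw [ha, dist_eq_zero.1 h, map_one]
  · obtain ⟨ε, hε, hle⟩ := exists_pos_le_graevDist hG hagree hclosed (fun i => le_rfl)
      (fun i => by simpa using hclosed i) hk
    have := hle 1
    rw [map_one, h] at this
    exact absurd this (not_le.2 hε)

/-- The amalgam with the Graev metric. -/
@[reducible]
noncomputable def graevMetricSpace [Nonempty Λ]
    (hG : ∀ i, IsTwoSidedInvariant (dist : G i → G i → ℝ))
    (hagree : ∀ i j, ∀ a b : A, dist (φ i a) (φ i b) = dist (φ j a) (φ j b))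
    (hclosed : ∀ i, IsClosed (Set.range (φ i))) : MetricSpace (PushoutI φ) where
  dist := graevDist φ
  dist_self := graevDist_self
  dist_comm := graevDist_comm
  dist_triangle := graevDist_triangle
  eq_of_dist_eq_zero := eq_of_graevDist_eq_zero hG hagree hclosed

theorem amalgamInclusion_injective [Nonempty Λ]
    (hG : ∀ i, IsTwoSidedInvariant (dist : G i → G i → ℝ))
    (hagree : ∀ i j, ∀ a b : A, dist (φ i a) (φ i b) = dist (φ j a) (φ j b))
    (hclosed : ∀ i, IsClosed (Set.range (φ i))) (hH : ∀ i, (φ i).range ≤ H i) :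
    Function.Injective (amalgamInclusion φ H hH) := by
  intro f g hfg
  refine eq_of_graevDist_eq_zero (fun i => (hG i).subgroup (H i)) hagree
    (isClosed_range_embedSub hclosed) ?_
  rw [graevDist_amalgamInclusion hG hagree, hfg, graevDist_self]

theorem isClosed_range_amalgamInclusion [Nonempty Λ] [MetricSpace (PushoutI φ)]
    (hd : ∀ f g : PushoutI φ, dist f g = graevDist φ f g)
    (hG : ∀ i, IsTwoSidedInvariant (dist : G i → G i → ℝ))
    (hagree : ∀ i j, ∀ a b : A, dist (φ i a) (φ i b) = dist (φ j a) (φ j b))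
    (hclosed : ∀ i, IsClosed (Set.range (φ i))) (hH : ∀ i, (φ i).range ≤ H i)
    (hHc : ∀ i, IsClosed (H i : Set (G i))) :
    IsClosed (Set.range (amalgamInclusion φ H hH)) := by
  rw [← isOpen_compl_iff, Metric.isOpen_iff]
  intro f hf
  obtain ⟨ε, hε, h⟩ := exists_pos_le_graevDist hG hagree hclosed hH hHc hf
  refine ⟨ε, hε, ?_⟩
  rintro _ hg ⟨l, rfl⟩
  rw [Metric.mem_ball, dist_comm, hd] at hg
  exact absurd hg (not_lt.2 (h l))

end Positivity

/-! ### Maximality and the universal property -/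

section Universal

variable {A : Type*} [Group A] {Λ : Type*} [Nonempty Λ] {G : Λ → Type*} [∀ i, Group (G i)]
  [∀ i, MetricSpace (G i)] {φ : ∀ i, A →* G i}

/-- A two-sided invariant metric pulled back to the amalgam is bounded by a multiple of the Graev
distance as soon as it is so on letters. -/
theorem dist_le_mul_graevDist {T : Type*} [Group T] [MetricSpace T]
    (hT : IsTwoSidedInvariant (dist : T → T → ℝ)) (Ψ : PushoutI φ →* T) (K : ℝ≥0)
    (h : ∀ X Y : Letter G,
      dist (Ψ (letterVal φ X)) (Ψ (letterVal φ Y)) ≤ K * letterDist φ X Y)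
    (f g : PushoutI φ) : dist (Ψ f) (Ψ g) ≤ K * graevDist φ f g := by
  have key : ∀ α β : List (Letter G), α.length = β.length →
      dist (Ψ (wordVal φ α)) (Ψ (wordVal φ β)) ≤ K * wordDist φ α β := by
    intro α
    induction α with
    | nil =>
      intro β hl
      obtain rfl := List.length_eq_zero_iff.1 hl.symm
      simp [wordDist]
    | cons X α ih =>
      intro β hl
      cases β with
      | nil => simp at hl
      | cons Y β =>
        have h1 := ih β (by simpa using hl)
        rw [wordVal_cons, wordVal_cons, map_mul, map_mul, wordDist, List.zipWith_cons_cons,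
          List.sum_cons, mul_add]
        exact (hT.dist_mul_mul_le _ _ _ _).trans (add_le_add (h X Y) h1)
  rcases eq_or_ne K 0 with rfl | hK
  · obtain ⟨α, β, -, hl, rfl, rfl, -⟩ := exists_wordDist_lt (lt_add_one (graevDist φ f g))
    simpa using key α β hl
  · have hK : (0 : ℝ) < K := by positivity
    rw [← div_le_iff₀' hK]
    refine le_of_forall_gt fun r hr => ?_
    obtain ⟨α, β, -, hl, rfl, rfl, hlt⟩ := exists_wordDist_lt hr
    exact ((div_le_iff₀' hK).2 (key α β hl)).trans_lt hlt

theorem le_graevDist_of_extends (δ : MetricSpace (PushoutI φ)) (hδ : IsTwoSidedInvariant δ.dist)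
    (h : ∀ X Y : Letter G, δ.dist (letterVal φ X) (letterVal φ Y) = letterDist φ X Y)
    (f g : PushoutI φ) : δ.dist f g ≤ graevDist φ f g := by
  have := dist_le_mul_graevDist (φ := φ) hδ (MonoidHom.id _) 1
    (fun X Y => by rw [NNReal.coe_one, one_mul]; exact (h X Y).le) f g
  rwa [NNReal.coe_one, one_mul] at this

theorem existsUnique_lipschitz_extension [MetricSpace (PushoutI φ)]
    (hd : ∀ f g : PushoutI φ, dist f g = graevDist φ f g) {T : Type*} [Group T] [MetricSpace T]
    (hT : IsTwoSidedInvariant (dist : T → T → ℝ)) (K : ℝ≥0) (ψ : ∀ i, G i →* T)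
    (hψ : ∀ i, LipschitzWith K (ψ i)) (hA : ∀ i j, ∀ a : A, ψ i (φ i a) = ψ j (φ j a)) :
    ∃! Ψ : PushoutI φ →* T,
      LipschitzWith K Ψ ∧ ∀ i, ∀ x : G i, Ψ (PushoutI.of i x) = ψ i x := by
  have i : Λ := Classical.arbitrary Λ
  let Ψ : PushoutI φ →* T := PushoutI.lift ψ ((ψ i).comp (φ i))
    fun j => MonoidHom.ext fun a => hA j i a
  have hΨ : ∀ j, ∀ x : G j, Ψ (PushoutI.of j x) = ψ j x := fun j x => PushoutI.lift_of _ _ _ x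
  refine ⟨Ψ, ⟨LipschitzWith.of_dist_le_mul fun f g => ?_, hΨ⟩, fun Ψ' h => ?_⟩
  · rw [hd]
    refine dist_le_mul_graevDist hT Ψ K ?_ f g
    rintro ⟨i, x⟩ ⟨j, y⟩
    rw [letterVal, letterVal, hΨ, hΨ]
    by_cases hij : i = j
    · subst hij
      rw [letterDist_same]
      exact (hψ i).dist_le_mul x y
    · rw [letterDist_of_ne φ hij, Real.mul_iInf_of_nonneg K.coe_nonneg]
      refine le_ciInf fun a => ?_
      rw [mul_add]
      refine (dist_triangle _ (ψ i (φ i a)) _).trans (add_le_add ((hψ i).dist_le_mul _ _) ?_)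
      rw [hA i j a]
      exact (hψ j).dist_le_mul _ _
  · exact PushoutI.hom_ext_nonempty fun j => MonoidHom.ext fun x => (h.2 j x).trans (hΨ j x).symm

end Universal

/-! ### Density characters -/

section Density

theorem densityCharacter_le {X : Type*} [TopologicalSpace X] {S : Set X} (hS : Dense S) :
    densityCharacter X ≤ #S :=
  csInf_le' ⟨S, hS, rfl⟩

theorem exists_dense_mk_eq_densityCharacter (X : Type*) [TopologicalSpace X] :
    ∃ S : Set X, Dense S ∧ #S = densityCharacter X :=
  csInf_mem (s := {κ | ∃ S : Set X, Dense S ∧ #S = κ}) ⟨_, Set.univ, dense_univ, rfl⟩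

/-- A dense subset of a metric space bounds the density character of every isometrically embedded
space, up to `ℵ₀`: for every point of the dense subset and every `n`, choose a point of the embedded
space which is `1 / (n + 1)`-close to it. -/
theorem lift_densityCharacter_le_of_isometry {X : Type u} {Y : Type v} [MetricSpace X]
    [MetricSpace Y] {f : X → Y} (hf : Isometry f) {S : Set Y} (hS : Dense S) :
    Cardinal.lift.{v} (densityCharacter X) ≤ Cardinal.lift.{u} (max ℵ₀ #S) := by
  rcases isEmpty_or_nonempty X with hX | hX
  · have h0 : densityCharacter X ≤ #(∅ : Set X) := densityCharacter_le fun x => hX.elim x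
    rw [mk_eq_zero, nonpos_iff_eq_zero] at h0
    simp [h0]
  let F : S × ℕ → X := fun p =>
    Classical.epsilon fun x => dist (f x) p.1 < 1 / ((p.2 : ℝ) + 1)
  have hF : Dense (Set.range F) := by
    refine Metric.dense_iff.2 fun x ε hε => ?_
    obtain ⟨n, hn⟩ := exists_nat_one_div_lt (half_pos hε)
    obtain ⟨s, hs, hsS⟩ := Metric.dense_iff.1 hS (f x) (1 / ((n : ℝ) + 1)) Nat.one_div_pos_of_nat
    rw [Metric.mem_ball, dist_comm] at hs
    have h : dist (f (F (⟨s, hsS⟩, n))) s < 1 / ((n : ℝ) + 1) :=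
      Classical.epsilon_spec (p := fun x => dist (f x) s < 1 / ((n : ℝ) + 1)) ⟨x, hs⟩
    refine ⟨F (⟨s, hsS⟩, n), ?_, ⟨_, rfl⟩⟩
    rw [Metric.mem_ball, ← hf.dist_eq]
    rw [dist_comm] at hs
    linarith [dist_triangle (f (F (⟨s, hsS⟩, n))) s (f x)]
  calc Cardinal.lift.{v} (densityCharacter X) ≤ Cardinal.lift.{v} #(Set.range F) :=
        Cardinal.lift_le.2 (densityCharacter_le hF)
    _ ≤ Cardinal.lift.{u} #(S × ℕ) := mk_range_le_lift
    _ ≤ Cardinal.lift.{u} (max ℵ₀ #S) := by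
        refine Cardinal.lift_le.2 ?_
        rw [mk_prod, Cardinal.lift_uzero, mk_nat, lift_aleph0]
        refine (mul_le_max _ _).trans ?_
        rw [max_assoc, max_self, max_comm]

theorem aleph0_le_densityCharacter {X : Type*} [MetricSpace X] [Infinite X] :
    ℵ₀ ≤ densityCharacter X := by
  obtain ⟨S, hS, hc⟩ := exists_dense_mk_eq_densityCharacter X
  rw [← hc, Cardinal.aleph0_le_mk_iff, Set.infinite_coe_iff]
  intro hfin
  have := hfin.isClosed.closure_eq ▸ hS.closure_eq
  exact Set.infinite_univ (this ▸ hfin)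

end Density

section AmalgamDensity

variable {A : Type u} [Group A] {Λ : Type v} {G : Λ → Type w} [∀ i, Group (G i)]
  {φ : ∀ i, A →* G i}

/-- The values of the words with letters in prescribed subsets `S i ⊆ G i`, where `i` ranges over
the indices that satisfy `p`. -/
def wordValues (φ : ∀ i, A →* G i) (p : Λ → Prop) (S : ∀ i, Set (G i)) : Set (PushoutI φ) :=
  Set.range fun w : List (Σ i : {i // p i}, S i) =>
    wordVal φ (w.map fun X => (⟨X.1, X.2⟩ : Letter G))

/-- The number of words is bounded by `ℵ₀`, the sizes of the sets `S i` and the number of these. -/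
theorem mk_wordValues_le (p : Λ → Prop) (S : ∀ i, Set (G i)) :
    #(wordValues φ p S) ≤ max ℵ₀ (max (⨆ i : Λ, Cardinal.lift.{max u v} #(S i))
      (Cardinal.lift.{max u w} #{i // p i})) := by
  have hbdd : BddAbove (Set.range fun i : Λ => Cardinal.lift.{max u v} #(S i)) :=
    Cardinal.bddAbove_of_small
  have hrange : wordValues φ p S =
      Set.range fun w : ULift.{u} (List (Σ i : {i // p i}, S i)) =>
        wordVal φ (w.down.map fun X => (⟨X.1, X.2⟩ : Letter G)) :=
    (ULift.down_surjective.range_comp _).symm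
  have hsum : Cardinal.lift.{u} #(Σ i : {i // p i}, S i) ≤
      Cardinal.lift.{max u w} #{i // p i} * ⨆ i : Λ, Cardinal.lift.{max u v} #(S i) := by
    rw [mk_sigma, lift_sum]
    refine (sum_le_lift_mk_mul_iSup_lift _).trans (mul_le_mul_right ?_ _)
    refine ciSup_le' fun i => ?_
    rw [Cardinal.lift_lift]
    exact le_ciSup hbdd i.1
  rw [hrange]
  refine mk_range_le.trans ?_
  rw [mk_uLift]
  refine (Cardinal.lift_le.2 (mk_list_le_max _)).trans ?_
  rw [lift_max, lift_aleph0]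
  refine max_le (le_max_left _ _) (hsum.trans ((mul_le_max _ _).trans ?_))
  rw [max_comm, max_comm (Cardinal.lift.{max u w} #{i // p i})]

theorem exists_notMem_range {i : Λ} (hi : (φ i).range ≠ ⊤) : ∃ x : G i, x ∉ Set.range (φ i) := by
  by_contra! h
  exact hi (eq_top_iff.2 fun x _ => h x)

/-- If some factor differs from `A`, the factors that differ from `A` generate the amalgam. -/
theorem exists_word_range_ne_top [Nonempty Λ] (hne : ∃ i, (φ i).range ≠ ⊤) (f : PushoutI φ) :
    ∃ w : List (Letter G), wordVal φ w = f ∧ ∀ X ∈ w, (φ X.1).range ≠ ⊤ := by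
  obtain ⟨i, hi⟩ := hne
  obtain ⟨w, rfl⟩ := wordVal_surjective f
  induction w with
  | nil => exact ⟨[], rfl, by simp⟩
  | cons X w ih =>
    obtain ⟨w', hw', hp⟩ := ih
    by_cases hX : (φ X.1).range = ⊤
    · obtain ⟨a, ha⟩ : X.2 ∈ (φ X.1).range := hX ▸ Subgroup.mem_top _
      refine ⟨⟨i, φ i a⟩ :: w', ?_, List.forall_mem_cons.2 ⟨hi, hp⟩⟩
      rw [wordVal_cons, wordVal_cons, hw', of_apply_agree i X.1, ha]
    · exact ⟨X :: w', by rw [wordVal_cons, wordVal_cons, hw'], List.forall_mem_cons.2 ⟨hX, hp⟩⟩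

variable [∀ i, MetricSpace (G i)]

/-- The product of two elements outside `A` of different factors has infinite order, so the amalgam
is infinite. -/
theorem infinite_of_two_range_ne_top (hG : ∀ i, IsTwoSidedInvariant (dist : G i → G i → ℝ))
    (hagree : ∀ i j, ∀ a b : A, dist (φ i a) (φ i b) = dist (φ j a) (φ j b))
    (hclosed : ∀ i, IsClosed (Set.range (φ i))) {i j : Λ} (hij : i ≠ j) {x : G i} {y : G j}
    (hx : x ∉ Set.range (φ i)) (hy : y ∉ Set.range (φ j)) : Infinite (PushoutI φ) := by
  by_contra hfin
  rw [not_infinite_iff_finite] at hfin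
  obtain ⟨n, hn, h1⟩ := isOfFinOrder_iff_pow_eq_one.1
    (isOfFinOrder_of_finite (PushoutI.of i x * PushoutI.of j y : PushoutI φ))
  let W : ℕ → List (Letter G) := fun n => n.rec [] fun _ w => ⟨i, x⟩ :: ⟨j, y⟩ :: w
  have hval : ∀ n, wordVal φ (W n) = (PushoutI.of i x * PushoutI.of j y) ^ n := by
    intro n
    induction n with
    | zero => rfl
    | succ n ih => rw [pow_succ', ← ih, mul_assoc, ← wordVal_cons ⟨j, y⟩, ← wordVal_cons ⟨i, x⟩]
  have hmem : ∀ n, ∀ X ∈ W n, X.2 ∉ Set.range (φ X.1) := by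
    intro n
    induction n with
    | zero => simp [W]
    | succ n ih => exact List.forall_mem_cons.2 ⟨hx, List.forall_mem_cons.2 ⟨hy, ih⟩⟩
  have hchain : ∀ n, (W n).IsChain fun X Y => X.1 ≠ Y.1 := by
    intro n
    induction n with
    | zero => exact .nil
    | succ n ih =>
      refine List.isChain_cons_cons.2 ⟨hij, ?_⟩
      cases n with
      | zero => exact .singleton _
      | succ n => exact List.isChain_cons_cons.2 ⟨hij.symm, ih⟩
  obtain ⟨ε, hε, hle⟩ := exists_pos_le_dist_of_forall_notMem_range hclosed _ (hmem n)
  have hev : Evaluates φ (W n) i 1 0 :=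
    (Evaluates.nil i).of_wordVal_eq hG hagree (by rw [hval, h1, wordVal_nil])
  obtain ⟨n, rfl⟩ := Nat.exists_eq_succ_of_ne_zero hn.ne'
  rcases hev.reduced_cases hG hagree (hchain n.succ) hle (List.cons_ne_nil _ _) with h | ⟨z, h, -⟩
  · exact absurd h (not_le.2 hε)
  · exact absurd (congrArg List.length h) (by simp [W])

variable [Nonempty Λ]

/-- If the factors with index in `p` generate the amalgam, the words over dense subsets of these
factors represent a dense subset of the amalgam. -/
theorem dense_wordValues [MetricSpace (PushoutI φ)]
    (hd : ∀ f g : PushoutI φ, dist f g = graevDist φ f g) {p : Λ → Prop}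
    (hp : ∀ f : PushoutI φ, ∃ w : List (Letter G), wordVal φ w = f ∧ ∀ X ∈ w, p X.1)
    {S : ∀ i, Set (G i)} (hS : ∀ i, Dense (S i)) : Dense (wordValues φ p S) := by
  refine Metric.dense_iff.2 fun f ε hε => ?_
  obtain ⟨w, rfl, hw⟩ := hp f
  induction w generalizing ε with
  | nil => exact ⟨1, by simpa [wordVal_nil] using hε, [], by simp [wordVal_nil]⟩
  | cons X w ih =>
    obtain ⟨_, hg, v, rfl⟩ := ih (ε / 2) (half_pos hε) fun Y hY => hw Y (List.mem_cons_of_mem _ hY)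
    obtain ⟨y, hy, hyS⟩ := Metric.dense_iff.1 (hS X.1) X.2 (ε / 2) (half_pos hε)
    refine ⟨_, ?_, ⟨⟨X.1, hw X (by simp)⟩, ⟨y, hyS⟩⟩ :: v, rfl⟩
    rw [Metric.mem_ball, hd] at hg ⊢
    rw [Metric.mem_ball] at hy
    dsimp only at hg ⊢
    rw [List.map_cons, wordVal_cons, wordVal_cons]
    refine (graevDist_mul_mul_le _ _ _ _).trans_lt ?_
    linarith [graevDist_of_le (φ := φ) X.1 y X.2]

/-- Letters outside `A` from different factors are centres of disjoint balls, each of which meets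
every dense set. -/
theorem lift_mk_range_ne_top_le [MetricSpace (PushoutI φ)]
    (hd : ∀ f g : PushoutI φ, dist f g = graevDist φ f g)
    (hG : ∀ i, IsTwoSidedInvariant (dist : G i → G i → ℝ))
    (hagree : ∀ i j, ∀ a b : A, dist (φ i a) (φ i b) = dist (φ j a) (φ j b))
    (hclosed : ∀ i, IsClosed (Set.range (φ i))) {S : Set (PushoutI φ)} (hS : Dense S) :
    Cardinal.lift.{max u w} #{i : Λ // (φ i).range ≠ ⊤} ≤ #S := by
  choose x hx using fun i : {i : Λ // (φ i).range ≠ ⊤} => exists_notMem_range i.2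
  choose r hr hrle using fun i => exists_pos_le_dist_of_notMem (hclosed i.1) (hx i)
  choose s hs hsS using fun i => Metric.dense_iff.1 hS (PushoutI.of i.1 (x i)) (r i) (hr i)
  have hinj : Function.Injective fun i : ULift.{max u w} {i : Λ // (φ i).range ≠ ⊤} =>
      (⟨s i.down, hsS i.down⟩ : S) := by
    rintro ⟨i⟩ ⟨j⟩ hij
    by_contra hne
    have hne' : i.1 ≠ j.1 := fun h => hne (congrArg ULift.up (Subtype.ext h))
    have h1 : s i = s j := congrArg Subtype.val hij
    have h2 : dist (PushoutI.of i.1 (x i) : PushoutI φ) (PushoutI.of j.1 (x j)) =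
        letterDist φ ⟨i.1, x i⟩ ⟨j.1, x j⟩ := by
      rw [hd, ← graevDist_letterVal hG hagree]
      rfl
    have h3 : r i + r j ≤ letterDist φ ⟨i.1, x i⟩ ⟨j.1, x j⟩ := by
      rw [letterDist_of_ne φ hne']
      refine le_ciInf fun a => add_le_add (hrle i _ ⟨a, rfl⟩) ?_
      rw [dist_comm]
      exact hrle j _ ⟨a, rfl⟩
    have h4 := hs i
    have h5 := hs j
    rw [Metric.mem_ball] at h4 h5
    rw [← h1] at h5
    rw [dist_comm] at h4
    linarith [dist_triangle (PushoutI.of i.1 (x i) : PushoutI φ) (s i) (PushoutI.of j.1 (x j))]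
  exact mk_le_of_injective hinj

theorem densityCharacter_pushoutI [MetricSpace (PushoutI φ)]
    (hd : ∀ f g : PushoutI φ, dist f g = graevDist φ f g)
    (hG : ∀ i, IsTwoSidedInvariant (dist : G i → G i → ℝ))
    (hagree : ∀ i j, ∀ a b : A, dist (φ i a) (φ i b) = dist (φ j a) (φ j b))
    (hclosed : ∀ i, IsClosed (Set.range (φ i))) (h2 : 2 ≤ #{i : Λ // (φ i).range ≠ ⊤}) :
    densityCharacter (PushoutI φ) =
      max ℵ₀ (max (⨆ i : Λ, Cardinal.lift.{max u v} (densityCharacter (G i)))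
        (Cardinal.lift.{max u w} #{i : Λ // (φ i).range ≠ ⊤})) := by
  obtain ⟨i, j, hij⟩ := two_le_iff.1 h2
  obtain ⟨x, hxi⟩ := exists_notMem_range i.2
  obtain ⟨y, hyj⟩ := exists_notMem_range j.2
  have := infinite_of_two_range_ne_top hG hagree hclosed (fun h => hij (Subtype.ext h)) hxi hyj
  refine le_antisymm ?_ (max_le aleph0_le_densityCharacter (max_le (ciSup_le' fun k => ?_) ?_))
  · choose S hS hSc using fun i => exists_dense_mk_eq_densityCharacter (G i)
    simp only [← hSc]
    exact (densityCharacter_le (dense_wordValues hd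
      (exists_word_range_ne_top ⟨i.1, i.2⟩) hS)).trans (mk_wordValues_le _ _)
  · obtain ⟨S, hS, hSc⟩ := exists_dense_mk_eq_densityCharacter (PushoutI φ)
    have hiso : Isometry (PushoutI.of k : G k → PushoutI φ) := Isometry.of_dist_eq fun x y => by
      rw [hd, graevDist_of hG hagree]
    have := lift_densityCharacter_le_of_isometry hiso hS
    rw [hSc, max_eq_right aleph0_le_densityCharacter] at this
    rwa [Cardinal.lift_umax.{w, max u v},
      Cardinal.lift_id'.{w, max u v} (densityCharacter (PushoutI φ))] at this
  · obtain ⟨S, hS, hSc⟩ := exists_dense_mk_eq_densityCharacter (PushoutI φ)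
    rw [← hSc]
    exact lift_mk_range_ne_top_le hd hG hagree hclosed hS

theorem separableSpace_pushoutI [MetricSpace (PushoutI φ)]
    (hd : ∀ f g : PushoutI φ, dist f g = graevDist φ f g) [Countable Λ]
    [∀ i, TopologicalSpace.SeparableSpace (G i)] :
    TopologicalSpace.SeparableSpace (PushoutI φ) := by
  choose S hSc hS using fun i => TopologicalSpace.exists_countable_dense (G i)
  have : ∀ i, Countable (S i) := fun i => (hSc i).to_subtype
  refine ⟨wordValues φ (fun _ => True) S, Set.countable_range _, dense_wordValues hd ?_ hS⟩
  intro f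
  obtain ⟨w, hw⟩ := wordVal_surjective f
  exact ⟨w, hw, fun _ _ => trivial⟩

end AmalgamDensity

/-! ### The Graev metric on an amalgam of tsi groups -/

theorem mainTheorem2 {A : Type u} [Group A] {Λ : Type v} [Nonempty Λ]
    {G : Λ → Type w} [∀ i, Group (G i)] [∀ i, MetricSpace (G i)]
    (hG : ∀ i, IsTwoSidedInvariant (dist : G i → G i → ℝ))
    (φ : ∀ i, A →* G i) (hφ : ∀ i, Function.Injective (φ i))
    (hclosed : ∀ i, IsClosed (Set.range (φ i)))
    (hagree : ∀ i j, ∀ a b : A, dist (φ i a) (φ i b) = dist (φ j a) (φ j b)) :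
    -- the Graev distance is a metric; all topological notions below refer to it
    ∃ _ : MetricSpace (PushoutI φ), (∀ f g : PushoutI φ, dist f g = graevDist φ f g) ∧
    -- (i) extension of Lipschitz homomorphisms
    (∀ (T : Type t) [Group T] [MetricSpace T],
      IsTwoSidedInvariant (dist : T → T → ℝ) →
      ∀ (K : ℝ≥0) (ψ : ∀ i, G i →* T), (∀ i, LipschitzWith K (ψ i)) →
      (∀ i j, ∀ a : A, ψ i (φ i a) = ψ j (φ j a)) →
      ∃! Ψ : PushoutI φ →* T,
        LipschitzWith K Ψ ∧ ∀ i, ∀ x : G i, Ψ (PushoutI.of i x) = ψ i x) ∧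
    -- (ii) amalgams of subgroups
    (∀ (H : ∀ i, Subgroup (G i)) (hH : ∀ i, (φ i).range ≤ H i),
      Function.Injective (amalgamInclusion φ H hH) ∧
      (∀ f g : PushoutI (embedSub φ H hH),
        graevDist (embedSub φ H hH) f g =
          dist (amalgamInclusion φ H hH f) (amalgamInclusion φ H hH g)) ∧
      ((∀ i, IsClosed (H i : Set (G i))) →
        IsClosed (Set.range (amalgamInclusion φ H hH)))) ∧
    -- (iii) the Graev metric is the largest tsi metric that extends the amalgam metric
    (IsTwoSidedInvariant (graevDist φ) ∧
      (∀ x y : Letter G, graevDist φ (letterVal φ x) (letterVal φ y) = letterDist φ x y) ∧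
      ∀ δ : MetricSpace (PushoutI φ), IsTwoSidedInvariant δ.dist →
        (∀ x y : Letter G, δ.dist (letterVal φ x) (letterVal φ y) = letterDist φ x y) →
        ∀ f g : PushoutI φ, δ.dist f g ≤ graevDist φ f g) ∧
    -- (iv) density character
    (2 ≤ #{i : Λ // (φ i).range ≠ ⊤} →
      densityCharacter (PushoutI φ) =
        max ℵ₀ (max (⨆ i : Λ, Cardinal.lift.{max u v} (densityCharacter (G i)))
          (Cardinal.lift.{max u w} #{i : Λ // (φ i).range ≠ ⊤}))) ∧
    (Countable Λ → (∀ i, TopologicalSpace.SeparableSpace (G i)) →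
      TopologicalSpace.SeparableSpace (PushoutI φ)) := by
  let _ := graevMetricSpace hG hagree hclosed
  have hd : ∀ f g : PushoutI φ, dist f g = graevDist φ f g := fun _ _ => rfl
  refine ⟨_, hd, ?_, ?_, ⟨graevDist_isTwoSidedInvariant, graevDist_letterVal hG hagree,
    le_graevDist_of_extends⟩, densityCharacter_pushoutI hd hG hagree hclosed, ?_⟩
  · intro T _ _ hT K ψ hψ hA
    exact existsUnique_lipschitz_extension hd hT K ψ hψ hA
  · intro H hH
    refine ⟨amalgamInclusion_injective hG hagree hclosed hH,
      graevDist_amalgamInclusion hG hagree, ?_⟩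
    exact isClosed_range_amalgamInclusion hd hG hagree hclosed hH
  · intro _ _
    exact separableSpace_pushoutI hd
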